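/- Let $M$ be a smooth manifold (finite-dimensional, Hausdorff, second countable, without boundary), let $\mathfrak g$ be a finite-dimensional real Lie algebra equipped with a nondegenerate symmetric $\mathrm{ad}$-invariant bilinear form $\langle\cdot,\cdot\rangle$, let $\rho_M:\mathfrak g\to\mathcal X(M)$ be a Lie algebra homomorphism (so $M$ is a $\mathfrak g$-manifold), and let $\pi\in\mathcal X^2(M)$ be an arbitrary bivector field. Notation. Let $\chi_G\in\Lambda^3\mathfrak g$ be the trivector with $\chi_G(u^\vee,v^\vee,w^\vee)=\tfrac12\langle u,[v,w]\rangle$ for $u,v,w\in\mathfrak g$, where $u^\vee=\langle u,\cdot\rangle\in\mathfrak g^*$. Let $\rho_M^*:\Omega^1(M)\to C^\infty(M,\mathfrak g^*)$ be dual to $\rho_M$, write $\rho_M(u)(x)=\rho_M(u(x))(x)$ for $u\in C^\infty(M,\mathfrak g)$, and $\rho_M(\chi_G)(\alpha,\beta,\gamma)=\chi_G(\rho_M^*\alpha,\rho_M^*\beta,\rho_M^*\gamma)$. Let $\pi^\sharp:T^*M\to TM$, $\beta(\pi^\sharp\alpha)=\pi(\alpha,\beta)$, $\{f,g\}=\pi(df,dg)$,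 and let $\chi_\pi=[\pi,\pi]\in\mathcal X^3(M)$ be the trivector field with $\tfrac12\chi_\pi(df,dg,dh)=\{f,\{g,h\}\}+\{g,\{h,f\}\}+\{h,\{f,g\}\}$. For $1$-forms put $[\alpha,\beta]=\mathcal L_{\pi^\sharp\alpha}\beta-\mathcal L_{\pi^\sharp\beta}\alpha-d\pi(\alpha,\beta)$. On $\Gamma(T^*M\oplus\mathfrak g)=\Omega^1(M)\oplus C^\infty(M,\mathfrak g)$ consider the anchor $r(\alpha,u)=\pi^\sharp\alpha+\rho_M(u)$ and the unique skew-symmetric additive bracket satisfying the Leibniz identity $[\xi,f\xi']=f[\xi,\xi']+\mathcal L_{r(\xi)}(f)\,\xi'$ for $f\in C^\infty(M)$ and, for $\alpha,\beta\in\Omega^1(M)$ and constant $v,v'\in\mathfrak g$, $$[(\alpha,0),(\beta,0)]=\bigl([\alpha,\beta],\tfrac12\chi_G(\rho_M^*\alpha,\rho_M^*\beta,\cdot)\bigr),\quad [(0,v),(0,v')]=(0,[v,v']),\quad [(0,v),(\alpha,0)]=(\mathcal L_{\rho_M(v)}\alpha,0).$$ Then the following are equivalent: (i) $(M,\pi)$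 is a quasi-Poisson $\mathfrak g$-manifold, i.e. $\mathcal L_{\rho_M(v)}\pi=0$ for all $v\in\mathfrak g$ and $\chi_\pi=\rho_M(\chi_G)$; (ii) $r:\Omega^1(M)\oplus C^\infty(M,\mathfrak g)\to\mathcal X(M)$ preserves brackets: $r([\xi,\eta])=[r(\xi),r(\eta)]$ for all $\xi,\eta$; (iii) the bracket on $\Omega^1(M)\oplus C^\infty(M,\mathfrak g)$ satisfies the Jacobi identity; (iv) $(T^*M\oplus\mathfrak g,r,[\cdot,\cdot])$ is a Lie algebroid over $M$. -/

import Mathlib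

open scoped Manifold ContDiff
open Bundle

/-- A real Lie algebra whose underlying vector space carries a norm. The norm is only used, in
finite dimension, to make sense of smooth maps into the Lie algebra; no compatibility with the
bracket is required. -/
class NormedLieAlgebra (𝔤 : Type*) extends
  LieRing 𝔤, NormedAddCommGroup 𝔤, LieAlgebra ℝ 𝔤, NormedSpace ℝ 𝔤

namespace QPoisson

set_option linter.unusedSectionVars false

noncomputable section

variable {E : Type*} [NormedAddCommGroup E] [NormedSpace ℝ E]
  {M : Type*} [TopologicalSpace M] [ChartedSpace E M]

section Calculus

variable (E M)

/-- Smooth functions on `M` with values in the normed space `W`. -/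
abbrev SmoothMap (W : Type*) [NormedAddCommGroup W] [NormedSpace ℝ W] :=
  C^∞⟮𝓘(ℝ, E), M; 𝓘(ℝ, W), W⟯

variable [IsManifold 𝓘(ℝ, E) ∞ M]

/-- Smooth vector fields: smooth sections of the tangent bundle. -/
abbrev SmoothVectorField :=
  Cₛ^∞⟮𝓘(ℝ, E); E, (TangentSpace 𝓘(ℝ, E) : M → Type _)⟯

/-- Smooth 1-forms: smooth sections of the cotangent bundle. -/
abbrev OneForm :=
  Cₛ^∞⟮𝓘(ℝ, E); E →L[ℝ] ℝ, fun x : M ↦ TangentSpace 𝓘(ℝ, E) x →L[ℝ] ℝ⟯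

variable {E M}

/-- The product of a section of a vector bundle with a function. -/
def smulSection {F : Type*} [NormedAddCommGroup F] [NormedSpace ℝ F] {V : M → Type*}
    [TopologicalSpace (TotalSpace F V)] [∀ x, TopologicalSpace (V x)] [FiberBundle F V]
    [∀ x, AddCommGroup (V x)] [∀ x, Module ℝ (V x)] [VectorBundle ℝ F V]
    (f : SmoothMap E M ℝ) (s : Cₛ^∞⟮𝓘(ℝ, E); F, V⟯) : Cₛ^∞⟮𝓘(ℝ, E); F, V⟯ :=
  ⟨fun x ↦ f x • s x, f.contMDiff.smul_section s.contMDiff⟩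

theorem section_sum_apply {F : Type*} [NormedAddCommGroup F] [NormedSpace ℝ F] {V : M → Type*}
    [TopologicalSpace (TotalSpace F V)] [∀ x, TopologicalSpace (V x)] [FiberBundle F V]
    [∀ x, AddCommGroup (V x)] [∀ x, Module ℝ (V x)] [VectorBundle ℝ F V]
    {ι : Type*} (t : Finset ι) (s : ι → Cₛ^∞⟮𝓘(ℝ, E); F, V⟯) (x : M) :
    (∑ i ∈ t, s i) x = ∑ i ∈ t, s i x := by
  have := congrFun (map_sum (ContMDiffSection.coeAddHom 𝓘(ℝ, E) F ∞ V) s t) x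
  rw [Finset.sum_apply] at this
  exact this

theorem contMDiff_of_eq_section {F : Type*} [NormedAddCommGroup F] [NormedSpace ℝ F]
    {V : M → Type*} [TopologicalSpace (TotalSpace F V)] [∀ x, TopologicalSpace (V x)]
    [FiberBundle F V] {s : ∀ x, V x} (t : Cₛ^∞⟮𝓘(ℝ, E); F, V⟯) (h : s = ⇑t) :
    ContMDiff 𝓘(ℝ, E) (𝓘(ℝ, E).prod 𝓘(ℝ, F)) ∞ (fun x ↦ TotalSpace.mk' F x (s x)) := by
  subst h
  exact t.contMDiff

theorem contMDiffAt_pair {φ : ∀ x : M, TangentSpace 𝓘(ℝ, E) x →L[ℝ] ℝ}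
    {X : ∀ x : M, TangentSpace 𝓘(ℝ, E) x} {x : M}
    (hφ : ContMDiffAt 𝓘(ℝ, E) (𝓘(ℝ, E).prod 𝓘(ℝ, E →L[ℝ] ℝ)) ∞
      (fun y ↦ TotalSpace.mk' (E →L[ℝ] ℝ)
        (E := fun y : M ↦ TangentSpace 𝓘(ℝ, E) y →L[ℝ] ℝ) y (φ y)) x)
    (hX : ContMDiffAt 𝓘(ℝ, E) (𝓘(ℝ, E).prod 𝓘(ℝ, E)) ∞
      (fun y ↦ TotalSpace.mk' E (E := fun y : M ↦ TangentSpace 𝓘(ℝ, E) y) y (X y)) x) :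
    ContMDiffAt 𝓘(ℝ, E) 𝓘(ℝ, ℝ) ∞ (fun y ↦ φ y (X y)) x := by
  have := ContMDiffAt.clm_bundle_apply (F₂ := ℝ) (E₂ := Trivial M ℝ) hφ hX
  exact (contMDiffAt_section _).1 this

theorem contMDiffAt_dir {W : Type*} [NormedAddCommGroup W] [NormedSpace ℝ W]
    {f : M → W} {X : ∀ x : M, TangentSpace 𝓘(ℝ, E) x} {x : M}
    (hf : ContMDiffAt 𝓘(ℝ, E) 𝓘(ℝ, W) ∞ f x)
    (hX : ContMDiffAt 𝓘(ℝ, E) (𝓘(ℝ, E).prod 𝓘(ℝ, E)) ∞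
      (fun y ↦ TotalSpace.mk' E (E := fun y : M ↦ TangentSpace 𝓘(ℝ, E) y) y (X y)) x) :
    ContMDiffAt 𝓘(ℝ, E) 𝓘(ℝ, W) ∞ (fun y ↦ mvfderiv 𝓘(ℝ, E) f y (X y)) x := by
  have h1 := hf.mfderiv_const (m := ∞) (by simp)
  have h2 := ContMDiffAt.clm_apply_of_inCoordinates (b₁ := id) (b₂ := f)
    (E₁ := fun y : M ↦ TangentSpace 𝓘(ℝ, E) y) (E₂ := fun w : W ↦ TangentSpace 𝓘(ℝ, W) w)
    (ϕ := fun y ↦ mfderiv 𝓘(ℝ, E) 𝓘(ℝ, W) f y) (v := X) h1 hX hf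
  exact ((contMDiff_snd_tangentBundle_modelSpace W 𝓘(ℝ, W)).contMDiffAt).comp x h2

theorem contMDiffAt_finsum_aux {W ι : Type*} [NormedAddCommGroup W] [NormedSpace ℝ W] [Fintype ι]
    (f : ι → M → W) {x : M} (h : ∀ i, ContMDiffAt 𝓘(ℝ, E) 𝓘(ℝ, W) ∞ (f i) x) :
    ContMDiffAt 𝓘(ℝ, E) 𝓘(ℝ, W) ∞ (fun y ↦ ∑ i, f i y) x :=
  contMDiffAt_finsetSum fun i _ ↦ h i

theorem contMDiffAt_oneForm [FiniteDimensional ℝ E]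
    {φ : ∀ x : M, TangentSpace 𝓘(ℝ, E) x →L[ℝ] ℝ} {x : M}
    (h : ∀ v : TangentSpace 𝓘(ℝ, E) x, ContMDiffAt 𝓘(ℝ, E) 𝓘(ℝ, ℝ) ∞
      (fun y ↦ φ y (FiberBundle.extend E v y)) x) :
    ContMDiffAt 𝓘(ℝ, E) (𝓘(ℝ, E).prod 𝓘(ℝ, E →L[ℝ] ℝ)) ∞
      (fun y ↦ TotalSpace.mk' (E →L[ℝ] ℝ)
        (E := fun y : M ↦ TangentSpace 𝓘(ℝ, E) y →L[ℝ] ℝ) y (φ y)) x := by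
  refine (contMDiffAt_hom_bundle (E₁ := fun y : M ↦ TangentSpace 𝓘(ℝ, E) y)
    (E₂ := Trivial M ℝ) _).2 ⟨contMDiffAt_id, ?_⟩
  let b := Module.finBasis ℝ E
  have key : ∀ g : M → E →L[ℝ] ℝ,
      (∀ e : E, ContMDiffAt 𝓘(ℝ, E) 𝓘(ℝ, ℝ) ∞ (fun y ↦ g y e) x) →
      ContMDiffAt 𝓘(ℝ, E) 𝓘(ℝ, E →L[ℝ] ℝ) ∞ g x := by
    intro g hg
    have : g = fun y ↦ ∑ i, g y (b i) • LinearMap.toContinuousLinearMap (b.coord i) := by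
      funext y
      ext e
      conv_lhs => rw [← b.sum_repr e, map_sum]
      simp [mul_comm]
    rw [this]
    exact contMDiffAt_finsum_aux _ fun i ↦ (hg _).smul contMDiffAt_const
  refine key _ fun e ↦ ?_
  have he := h ((trivializationAt E (TangentSpace 𝓘(ℝ, E)) x).symm x e)
  refine he.congr_of_eventuallyEq ?_
  have hx := FiberBundle.mem_baseSet_trivializationAt' (F := E)
    (E := (TangentSpace 𝓘(ℝ, E) : M → Type _)) x
  filter_upwards [(trivializationAt E (TangentSpace 𝓘(ℝ, E) : M → Type _) x).open_baseSet.mem_nhds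
    hx] with y hy
  simp [ContinuousLinearMap.inCoordinates, FiberBundle.extend]
  rw [Trivialization.apply_mk_symm _ hx, Trivialization.symmL_apply _ hy]

/-- The value `α(X)` of a 1-form on a vector field. -/
def pair (α : OneForm E M) (X : SmoothVectorField E M) : SmoothMap E M ℝ :=
  ⟨fun x ↦ α x (X x), fun x ↦ contMDiffAt_pair (α.contMDiff x) (X.contMDiff x)⟩

/-- The derivative `L_X f` of a (vector-valued) function along a vector field. -/
def dirDeriv {W : Type*} [NormedAddCommGroup W] [NormedSpace ℝ W]
    (X : SmoothVectorField E M) (f : SmoothMap E M W) : SmoothMap E M W :=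
  ⟨fun x ↦ mvfderiv 𝓘(ℝ, E) f x (X x),
    fun x ↦ contMDiffAt_dir (f.contMDiff x) (X.contMDiff x)⟩

variable [FiniteDimensional ℝ E]

/-- The differential of a function. -/
def diff (f : SmoothMap E M ℝ) : OneForm E M :=
  ⟨fun x ↦ mvfderiv 𝓘(ℝ, E) f x, fun x ↦ contMDiffAt_oneForm fun v ↦
    contMDiffAt_dir (f.contMDiff x) (FiberBundle.contMDiffAt_extend _ _ v)⟩

theorem isManifold_minSmoothness_two : IsManifold 𝓘(ℝ, E) (minSmoothness ℝ 2) M := by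
  have : IsManifold 𝓘(ℝ, E) 2 M := inferInstance
  simpa using this

theorem contMDiffAt_mlieBracket {X Y : ∀ x : M, TangentSpace 𝓘(ℝ, E) x} {x : M}
    (hX : ContMDiffAt 𝓘(ℝ, E) (𝓘(ℝ, E).prod 𝓘(ℝ, E)) ∞
      (fun y ↦ TotalSpace.mk' E (E := fun y : M ↦ TangentSpace 𝓘(ℝ, E) y) y (X y)) x)
    (hY : ContMDiffAt 𝓘(ℝ, E) (𝓘(ℝ, E).prod 𝓘(ℝ, E)) ∞
      (fun y ↦ TotalSpace.mk' E (E := fun y : M ↦ TangentSpace 𝓘(ℝ, E) y) y (Y y)) x) :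
    ContMDiffAt 𝓘(ℝ, E) (𝓘(ℝ, E).prod 𝓘(ℝ, E)) ∞
      (fun y ↦ TotalSpace.mk' E (E := fun y : M ↦ TangentSpace 𝓘(ℝ, E) y) y
        (VectorField.mlieBracket 𝓘(ℝ, E) X Y y)) x := by
  have : CompleteSpace E := FiniteDimensional.complete ℝ E
  have : IsManifold 𝓘(ℝ, E) (minSmoothness ℝ 2) M := isManifold_minSmoothness_two
  have : IsManifold 𝓘(ℝ, E) (((⊤ : ℕ∞) : WithTop ℕ∞) + 1) M := by simpa
  exact ContMDiffAt.mlieBracket_vectorField (m := ⊤) (n := ⊤) hX hY (by simp)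

/-- The Lie bracket of smooth vector fields. -/
def vfBracket (X Y : SmoothVectorField E M) : SmoothVectorField E M :=
  ⟨VectorField.mlieBracket 𝓘(ℝ, E) X Y, fun x ↦
    contMDiffAt_mlieBracket (X.contMDiff x) (Y.contMDiff x)⟩

theorem mdifferentiableAt_pair (α : OneForm E M) {Y : ∀ x : M, TangentSpace 𝓘(ℝ, E) x} {x : M}
    (hY : MDifferentiableAt 𝓘(ℝ, E) (𝓘(ℝ, E).prod 𝓘(ℝ, E))
      (fun y ↦ TotalSpace.mk' E (E := fun y : M ↦ TangentSpace 𝓘(ℝ, E) y) y (Y y)) x) :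
    MDifferentiableAt 𝓘(ℝ, E) 𝓘(ℝ, ℝ) (fun y ↦ α y (Y y)) x := by
  have := MDifferentiableAt.clm_bundle_apply (F₂ := ℝ) (E₂ := Trivial M ℝ)
    (α.mdifferentiableAt (x := x)) hY
  exact (mdifferentiableAt_section 𝓘(ℝ, E) _).1 this

theorem tensorialAt_lieDerivative (X : SmoothVectorField E M) (α : OneForm E M) (x : M) :
    TensorialAt 𝓘(ℝ, E) E (fun Y : ∀ x : M, TangentSpace 𝓘(ℝ, E) x ↦
      mvfderiv 𝓘(ℝ, E) (fun y ↦ α y (Y y)) x (X x)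
        - α x (VectorField.mlieBracket 𝓘(ℝ, E) X Y x)) x where
  smul {f Y} hf hY := by
    have hp := mdifferentiableAt_pair α hY
    have e : (fun y ↦ α y ((f • Y) y)) = f * fun y ↦ α y (Y y) := by
      funext y; simp
    have : CompleteSpace E := FiniteDimensional.complete ℝ E
    have : IsManifold 𝓘(ℝ, E) (minSmoothness ℝ 2) M := isManifold_minSmoothness_two
    rw [e, mvfderiv_mul hf hp, VectorField.mlieBracket_smul_right hf hY]
    simp
    ring
  add {Y Z} hY hZ := by
    have hp := mdifferentiableAt_pair α hY
    have hq := mdifferentiableAt_pair α hZ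
    have e : (fun y ↦ α y ((Y + Z) y)) = (fun y ↦ α y (Y y)) + fun y ↦ α y (Z y) := by
      funext y; simp
    have : CompleteSpace E := FiniteDimensional.complete ℝ E
    have : IsManifold 𝓘(ℝ, E) (minSmoothness ℝ 2) M := isManifold_minSmoothness_two
    rw [e, mvfderiv_add hp hq, VectorField.mlieBracket_add_right hY hZ]
    simp
    ring

/-- The Lie derivative of a 1-form along a vector field: the 1-form determined by
`(L_X α)(Y) = L_X (α(Y)) - α([X, Y])`. -/
def lieDerivative (X : SmoothVectorField E M) (α : OneForm E M) : OneForm E M :=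
  ⟨fun x ↦ TensorialAt.mkHom _ x (tensorialAt_lieDerivative X α x), fun x ↦ by
    refine contMDiffAt_oneForm fun v ↦ ?_
    have hv := FiberBundle.contMDiffAt_extend (k := ∞) 𝓘(ℝ, E) E v
    have hX := X.contMDiff x
    have h1 := contMDiffAt_dir (contMDiffAt_pair (α.contMDiff x) hv) hX
    have h2 := contMDiffAt_pair (α.contMDiff x) (contMDiffAt_mlieBracket hX hv)
    refine (h1.sub h2).congr_of_eventuallyEq ?_
    obtain ⟨s, hs, hsv⟩ := FiberBundle.exists_contMDiffOn_extend (k := ∞) 𝓘(ℝ, E) E v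
    filter_upwards [eventually_mem_nhds_iff.2 hs] with y hy
    exact TensorialAt.mkHom_apply (tensorialAt_lieDerivative X α y)
      ((hsv.contMDiffAt hy).mdifferentiableAt (by simp))⟩

theorem pair_lieDerivative (X Y : SmoothVectorField E M) (α : OneForm E M) :
    pair (lieDerivative X α) Y = dirDeriv X (pair α Y) - pair α (vfBracket X Y) := by
  ext x
  exact TensorialAt.mkHom_apply (tensorialAt_lieDerivative X α x) Y.mdifferentiableAt

/-- A bivector field `π`, encoded by the smooth skew-symmetric bundle map
`π♯ : T*M → TM`, `β(π♯ α) = π(α, β)`. -/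
structure BivectorField (E : Type*) [NormedAddCommGroup E] [NormedSpace ℝ E]
    (M : Type*) [TopologicalSpace M] [ChartedSpace E M] [IsManifold 𝓘(ℝ, E) ∞ M] where
  /-- The bundle map `π♯`. -/
  sharp : Cₛ^∞⟮𝓘(ℝ, E); (E →L[ℝ] ℝ) →L[ℝ] E,
    fun x : M ↦ (TangentSpace 𝓘(ℝ, E) x →L[ℝ] ℝ) →L[ℝ] TangentSpace 𝓘(ℝ, E) x⟯
  skew : ∀ (x : M) (a b : TangentSpace 𝓘(ℝ, E) x →L[ℝ] ℝ), b (sharp x a) = -a (sharp x b)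

namespace BivectorField

variable (P : BivectorField E M)

/-- The vector field `π♯ α`. -/
def sharpForm (α : OneForm E M) : SmoothVectorField E M :=
  ⟨fun x ↦ P.sharp x (α x), P.sharp.contMDiff.clm_bundle_apply α.contMDiff⟩

/-- The function `π(α, β) = β(π♯ α)`. -/
def eval (α β : OneForm E M) : SmoothMap E M ℝ := pair β (P.sharpForm α)

/-- The bracket `{f, g} = π(df, dg)`. -/
def poisson (f g : SmoothMap E M ℝ) : SmoothMap E M ℝ := P.eval (diff f) (diff g)

/-- The bracket `[α, β] = L_{π♯ α} β - L_{π♯ β} α - d(π(α, β))` on 1-forms. -/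
def formBracket (α β : OneForm E M) : OneForm E M :=
  lieDerivative (P.sharpForm α) β - lieDerivative (P.sharpForm β) α - diff (P.eval α β)

/-- The trivector field `χ_π = [π, π]` (Schouten bracket), as a skew-symmetric triderivation of
`C^∞(M)`: its value `χ_π(df, dg, dh) = 2 ({f, {g, h}} + {g, {h, f}} + {h, {f, g}})`. -/
def schoutenSquare (f g h : SmoothMap E M ℝ) : SmoothMap E M ℝ :=
  (2 : ℝ) • (P.poisson f (P.poisson g h) + P.poisson g (P.poisson h f)
    + P.poisson h (P.poisson f g))

/-- The value `(L_X π)(α, β)` of the Lie derivative of the bivector field `π` along `X`. -/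
def lieDeriv (X : SmoothVectorField E M) (α β : OneForm E M) : SmoothMap E M ℝ :=
  dirDeriv X (P.eval α β) - P.eval (lieDerivative X α) β - P.eval α (lieDerivative X β)

end BivectorField

end Calculus

section Quadratic

/-- A nondegenerate symmetric bilinear form on `𝔤` that is invariant under the adjoint action. -/
structure InvariantForm (𝔤 : Type*) [NormedLieAlgebra 𝔤] where
  form : LinearMap.BilinForm ℝ 𝔤
  symm : form.IsSymm
  nondegenerate : form.Nondegenerate
  invariant : form.lieInvariant 𝔤

variable {𝔤 : Type*} [NormedLieAlgebra 𝔤] [FiniteDimensional ℝ 𝔤]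

/-- The trivector `χ_G ∈ Λ³𝔤`, as a (skew-symmetric) trilinear form on `𝔤*`. It is dual to the
Cartan 3-form: `χ_G(u^∨, v^∨, w^∨) = ½ ⟨u, [v, w]⟩`, where `u^∨ = ⟨u, ·⟩`. -/
def InvariantForm.trivector (B : InvariantForm 𝔤) :
    Module.Dual ℝ 𝔤 →ₗ[ℝ] Module.Dual ℝ 𝔤 →ₗ[ℝ] Module.Dual ℝ 𝔤 →ₗ[ℝ] ℝ :=
  let s : Module.Dual ℝ 𝔤 →ₗ[ℝ] 𝔤 := (B.form.toDual B.nondegenerate).symm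
  LinearMap.mk₂ ℝ
    (fun μ ν ↦ (1 / 2 : ℝ) • (B.form (s μ) ∘ₗ (LieAlgebra.ad ℝ 𝔤 (s ν)).comp s))
    (by intros; ext; simp [mul_add]) (by intros; ext; simp; ring)
    (by intros; ext; simp [mul_add]) (by intros; ext; simp; ring)

theorem InvariantForm.trivector_apply (B : InvariantForm 𝔤) (u v w : 𝔤) :
    B.trivector (B.form u) (B.form v) (B.form w) = (1 / 2) * B.form u ⁅v, w⁆ := by
  have h (u : 𝔤) : (B.form.toDual B.nondegenerate).symm (B.form u) = u := by
    rw [LinearEquiv.symm_apply_eq]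
    rfl
  simp [trivector, h]

/-- The contraction `i_{μ ∧ ν} χ = χ(μ, ν, ·) ∈ 𝔤** = 𝔤` of a trivector. -/
def contract (χ : Module.Dual ℝ 𝔤 →ₗ[ℝ] Module.Dual ℝ 𝔤 →ₗ[ℝ] Module.Dual ℝ 𝔤 →ₗ[ℝ] ℝ)
    (μ ν : Module.Dual ℝ 𝔤) : 𝔤 :=
  (Module.evalEquiv ℝ 𝔤).symm (χ μ ν)

end Quadratic

section Action

variable [IsManifold 𝓘(ℝ, E) ∞ M] [FiniteDimensional ℝ E]

/-- An infinitesimal action of `𝔤` on `M`: a Lie algebra homomorphism `𝔤 → 𝒳(M)`. -/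
structure InfinitesimalAction (𝔤 : Type*) [NormedLieAlgebra 𝔤]
    (E : Type*) [NormedAddCommGroup E] [NormedSpace ℝ E] [FiniteDimensional ℝ E]
    (M : Type*) [TopologicalSpace M] [ChartedSpace E M] [IsManifold 𝓘(ℝ, E) ∞ M] where
  toFun : 𝔤 →ₗ[ℝ] SmoothVectorField E M
  map_lie : ∀ u v : 𝔤, toFun ⁅u, v⁆ = vfBracket (toFun u) (toFun v)

variable {𝔤 : Type*} [NormedLieAlgebra 𝔤] [FiniteDimensional ℝ 𝔤]

namespace InfinitesimalAction

variable (ρ : InfinitesimalAction 𝔤 E M)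

/-- The dual map `ρ_M^* : T*_x M → 𝔤*`. -/
def dualMap (x : M) (a : TangentSpace 𝓘(ℝ, E) x →L[ℝ] ℝ) : Module.Dual ℝ 𝔤 where
  toFun v := a (ρ.toFun v x)
  map_add' := by simp
  map_smul' := by simp

end InfinitesimalAction

variable (ρ : InfinitesimalAction 𝔤 E M) (B : InvariantForm 𝔤) (P : BivectorField E M)

/-- `(M, π)` is a quasi-Poisson `𝔤`-manifold: `π` is `𝔤`-invariant and `χ_π = ρ_M(χ_G)`. -/
structure IsQuasiPoisson : Prop where
  invariant : ∀ (v : 𝔤) (α β : OneForm E M), P.lieDeriv (ρ.toFun v) α β = 0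
  schouten : ∀ (f g h : SmoothMap E M ℝ) (x : M), P.schoutenSquare f g h x =
    B.trivector (ρ.dualMap x (diff f x)) (ρ.dualMap x (diff g x)) (ρ.dualMap x (diff h x))

/-- The component of a smooth `𝔤`-valued function along a linear functional on `𝔤`. -/
def coordMap {W : Type*} [NormedAddCommGroup W] [NormedSpace ℝ W] [FiniteDimensional ℝ W]
    (l : W →ₗ[ℝ] ℝ) (u : SmoothMap E M W) : SmoothMap E M ℝ :=
  ⟨fun x ↦ l (u x), (LinearMap.toContinuousLinearMap l).contMDiff.comp u.contMDiff⟩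

theorem lieDerivative_add_left (X Y : SmoothVectorField E M) (α : OneForm E M) :
    lieDerivative (X + Y) α = lieDerivative X α + lieDerivative Y α := by
  have : IsManifold 𝓘(ℝ, E) (minSmoothness ℝ 2) M := isManifold_minSmoothness_two
  have : CompleteSpace E := FiniteDimensional.complete ℝ E
  ext x w
  change mvfderiv 𝓘(ℝ, E) _ x (X x + Y x) - α x (VectorField.mlieBracket 𝓘(ℝ, E) (⇑X + ⇑Y) _ x)
    = mvfderiv 𝓘(ℝ, E) _ x (X x) - α x (VectorField.mlieBracket 𝓘(ℝ, E) X _ x)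
      + (mvfderiv 𝓘(ℝ, E) _ x (Y x) - α x (VectorField.mlieBracket 𝓘(ℝ, E) Y _ x))
  rw [VectorField.mlieBracket_add_left X.mdifferentiableAt Y.mdifferentiableAt, map_add, map_add]
  abel

theorem lieDerivative_smul_left (c : ℝ) (X : SmoothVectorField E M) (α : OneForm E M) :
    lieDerivative (c • X) α = c • lieDerivative X α := by
  have : IsManifold 𝓘(ℝ, E) (minSmoothness ℝ 2) M := isManifold_minSmoothness_two
  have : CompleteSpace E := FiniteDimensional.complete ℝ E
  ext x w
  change mvfderiv 𝓘(ℝ, E) _ x (c • X x) - α x (VectorField.mlieBracket 𝓘(ℝ, E) (c • ⇑X) _ x)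
    = c • (mvfderiv 𝓘(ℝ, E) _ x (X x) - α x (VectorField.mlieBracket 𝓘(ℝ, E) X _ x))
  rw [VectorField.mlieBracket_const_smul_left X.mdifferentiableAt, map_smul, map_smul, smul_sub]

theorem InfinitesimalAction.apply_eq_sum (v : 𝔤) : ρ.toFun v =
    ∑ i, (Module.finBasis ℝ 𝔤).coord i v • ρ.toFun (Module.finBasis ℝ 𝔤 i) := by
  conv_lhs => rw [← (Module.finBasis ℝ 𝔤).sum_repr v, map_sum]
  simp

theorem lieDerivative_action_eq_sum (v : 𝔤) (α : OneForm E M) : lieDerivative (ρ.toFun v) α =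
    ∑ i, (Module.finBasis ℝ 𝔤).coord i v •
      lieDerivative (ρ.toFun (Module.finBasis ℝ 𝔤 i)) α := by
  let L : SmoothVectorField E M →ₗ[ℝ] OneForm E M :=
    { toFun := fun X ↦ lieDerivative X α
      map_add' := fun X Y ↦ lieDerivative_add_left X Y α
      map_smul' := fun c X ↦ lieDerivative_smul_left c X α }
  change L _ = ∑ i, _ • L _
  rw [ρ.apply_eq_sum v]
  simp

/-- The anchor on sections: `r(α, u) = π♯ α + ρ_M(u)`, where `ρ_M(u)(x) = ρ_M(u(x))(x)`. -/
def anchorSection (ξ : OneForm E M × SmoothMap E M 𝔤) : SmoothVectorField E M :=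
  P.sharpForm ξ.1 + ⟨fun x ↦ ρ.toFun (ξ.2 x) x, by
    refine contMDiff_of_eq_section (∑ i, smulSection
      (coordMap ((Module.finBasis ℝ 𝔤).coord i) ξ.2) (ρ.toFun (Module.finBasis ℝ 𝔤 i))) ?_
    funext x
    rw [ρ.apply_eq_sum, section_sum_apply, section_sum_apply]
    rfl⟩

/-- The 1-form `x ↦ (L_{ρ_M(u(x))} α)(x)`; for `u = ∑ᵢ uⁱ eᵢ` it is `∑ᵢ uⁱ L_{ρ_M(eᵢ)} α`. -/
def actionLie (u : SmoothMap E M 𝔤) (α : OneForm E M) : OneForm E M :=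
  ⟨fun x ↦ lieDerivative (ρ.toFun (u x)) α x, by
    refine contMDiff_of_eq_section (∑ i, smulSection
      (coordMap ((Module.finBasis ℝ 𝔤).coord i) u)
      (lieDerivative (ρ.toFun (Module.finBasis ℝ 𝔤 i)) α)) ?_
    funext x
    rw [lieDerivative_action_eq_sum, section_sum_apply, section_sum_apply]
    rfl⟩

/-- The pointwise bracket of smooth `𝔤`-valued functions. -/
def pointwiseLie (u v : SmoothMap E M 𝔤) : SmoothMap E M 𝔤 :=
  ⟨fun x ↦ ⁅u x, v x⁆,
    ((((LieModule.toEnd ℝ 𝔤 𝔤 : 𝔤 →ₗ[ℝ] 𝔤 →ₗ[ℝ] 𝔤).toContinuousBilinearMap).contMDiff.comp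
      u.contMDiff).clm_apply v.contMDiff)⟩

/-- The smooth function `i_{ρ_M^*(α ∧ β)} χ_G` with values in `𝔤`. -/
def contractForms (α β : OneForm E M) : SmoothMap E M 𝔤 :=
  ⟨fun x ↦ contract B.trivector (ρ.dualMap x (α x)) (ρ.dualMap x (β x)), by
    have h : (fun x ↦ contract B.trivector (ρ.dualMap x (α x)) (ρ.dualMap x (β x))) =
        fun x ↦ ∑ j, pair β (ρ.toFun (Module.finBasis ℝ 𝔤 j)) x •
          ∑ i, pair α (ρ.toFun (Module.finBasis ℝ 𝔤 i)) x • contract B.trivector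
            ((Module.finBasis ℝ 𝔤).coord i) ((Module.finBasis ℝ 𝔤).coord j) := by
      funext x
      conv_lhs => rw [← (Module.finBasis ℝ 𝔤).sum_dual_apply_smul_coord (ρ.dualMap x (α x)),
        ← (Module.finBasis ℝ 𝔤).sum_dual_apply_smul_coord (ρ.dualMap x (β x))]
      simp only [contract, map_sum, map_smul, LinearMap.sum_apply, LinearMap.smul_apply]
      rfl
    rw [h]
    exact fun x ↦ contMDiffAt_finsum_aux _ fun j ↦ ((pair β _).contMDiff x).smul
      (contMDiffAt_finsum_aux _ fun i ↦ ((pair α _).contMDiff x).smul contMDiffAt_const)⟩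

/-- The bracket on `Ω¹(M) ⊕ C^∞(M, 𝔤)`: the extension by the Leibniz identity, with respect to the
anchor `r`, of the bracket of 1-forms and of constant functions with values in `𝔤`. -/
def bracket (ξ η : OneForm E M × SmoothMap E M 𝔤) : OneForm E M × SmoothMap E M 𝔤 :=
  (P.formBracket ξ.1 η.1 + actionLie ρ ξ.2 η.1 - actionLie ρ η.2 ξ.1,
    (1 / 2 : ℝ) • contractForms ρ B ξ.1 η.1 + pointwiseLie ξ.2 η.2
      + dirDeriv (anchorSection ρ P ξ) η.2 - dirDeriv (anchorSection ρ P η) ξ.2)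

theorem lieDerivative_apply (X : SmoothVectorField E M) (α : OneForm E M) (x : M)
    (w : TangentSpace 𝓘(ℝ, E) x) : lieDerivative X α x w =
      mvfderiv 𝓘(ℝ, E) (fun y ↦ α y (FiberBundle.extend E w y)) x (X x)
        - α x (VectorField.mlieBracket 𝓘(ℝ, E) X (FiberBundle.extend E w) x) := rfl

theorem lieDerivative_smulSection (X : SmoothVectorField E M) (α : OneForm E M)
    (f : SmoothMap E M ℝ) : lieDerivative X (smulSection f α) =
      smulSection f (lieDerivative X α) + smulSection (dirDeriv X f) α := by
  ext x w
  have hw := mdifferentiableAt_pair α (FiberBundle.mdifferentiableAt_extend 𝓘(ℝ, E) E w)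
  change lieDerivative X _ x w = f x * lieDerivative X α x w + mvfderiv 𝓘(ℝ, E) f x (X x) * α x w
  rw [lieDerivative_apply, lieDerivative_apply]
  have e : (fun y ↦ (smulSection f α) y (FiberBundle.extend E w y)) =
    ⇑f * fun y ↦ α y (FiberBundle.extend E w y) := rfl
  have e' (z : TangentSpace 𝓘(ℝ, E) x) : (smulSection f α) x z = f x * α x z := rfl
  rw [e, e', mvfderiv_mul f.mdifferentiableAt hw]
  simp
  ring

theorem smulSection_lieDerivative (X : SmoothVectorField E M) (α : OneForm E M)
    (f : SmoothMap E M ℝ) : lieDerivative (smulSection f X) α =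
      smulSection f (lieDerivative X α) + smulSection (pair α X) (diff f) := by
  have : IsManifold 𝓘(ℝ, E) (minSmoothness ℝ 2) M := isManifold_minSmoothness_two
  have : CompleteSpace E := FiniteDimensional.complete ℝ E
  ext x w
  change lieDerivative _ α x w = f x * lieDerivative X α x w + α x (X x) * mvfderiv 𝓘(ℝ, E) f x w
  rw [lieDerivative_apply, lieDerivative_apply]
  have e : ⇑(smulSection f X) = ⇑f • ⇑X := rfl
  rw [e, VectorField.mlieBracket_smul_left f.mdifferentiableAt X.mdifferentiableAt]
  simp
  ring

theorem diff_mul (f g : SmoothMap E M ℝ) :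
    diff (f * g) = smulSection f (diff g) + smulSection g (diff f) := by
  ext x w
  change mvfderiv 𝓘(ℝ, E) (⇑f * ⇑g) x w = f x * mvfderiv 𝓘(ℝ, E) g x w
    + g x * mvfderiv 𝓘(ℝ, E) f x w
  rw [mvfderiv_mul f.mdifferentiableAt g.mdifferentiableAt]
  simp

theorem dirDeriv_smul {W : Type*} [NormedAddCommGroup W] [NormedSpace ℝ W]
    (X : SmoothVectorField E M) (f : SmoothMap E M ℝ) (u : SmoothMap E M W) :
    dirDeriv X (f • u) = f • dirDeriv X u + dirDeriv X f • u := by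
  ext x
  change mvfderiv 𝓘(ℝ, E) (⇑f • ⇑u) x (X x) = f x • mvfderiv 𝓘(ℝ, E) u x (X x)
    + mvfderiv 𝓘(ℝ, E) f x (X x) • u x
  rw [mvfderiv_smul f.mdifferentiableAt u.mdifferentiableAt]
  simp

theorem dirDeriv_const {W : Type*} [NormedAddCommGroup W] [NormedSpace ℝ W]
    (X : SmoothVectorField E M) (w : W) :
    dirDeriv X (ContMDiffMap.const w : SmoothMap E M W) = 0 := by
  ext x
  change mvfderiv 𝓘(ℝ, E) (fun _ ↦ w) x (X x) = 0
  rw [mvfderiv_const]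
  rfl

theorem dirDeriv_zero {W : Type*} [NormedAddCommGroup W] [NormedSpace ℝ W]
    (X : SmoothVectorField E M) : dirDeriv X (0 : SmoothMap E M W) = 0 :=
  dirDeriv_const X 0

theorem lieDerivative_zero_left (α : OneForm E M) :
    lieDerivative (0 : SmoothVectorField E M) α = 0 := by
  ext x w
  rw [lieDerivative_apply, ContMDiffSection.coe_zero, VectorField.mlieBracket_zero_left]
  simp

theorem lieDerivative_zero (X : SmoothVectorField E M) : lieDerivative X (0 : OneForm E M) = 0 := by
  ext x w
  rw [lieDerivative_apply]
  have e : (fun y ↦ (0 : OneForm E M) y (FiberBundle.extend E w y)) = fun _ ↦ (0 : ℝ) := rfl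
  rw [e, mvfderiv_const]
  simp

theorem actionLie_zero_left (α : OneForm E M) : actionLie ρ 0 α = 0 := by
  ext x w
  change lieDerivative (ρ.toFun 0) α x w = 0
  rw [map_zero, lieDerivative_zero_left]
  rfl

theorem actionLie_zero (u : SmoothMap E M 𝔤) : actionLie ρ u 0 = 0 := by
  ext x w
  change lieDerivative (ρ.toFun (u x)) 0 x w = 0
  rw [lieDerivative_zero]
  rfl

theorem contractForms_zero_left (α : OneForm E M) : contractForms ρ B 0 α = 0 := by
  ext x
  have e : ρ.dualMap x (0 : TangentSpace 𝓘(ℝ, E) x →L[ℝ] ℝ) = 0 := rfl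
  change contract B.trivector (ρ.dualMap x 0) _ = 0
  rw [e]
  simp [contract]

theorem formBracket_zero_left (α : OneForm E M) : P.formBracket 0 α = 0 := by
  have h1 : P.sharpForm 0 = 0 := by
    ext x
    exact map_zero (P.sharp x)
  have h2 : P.eval 0 α = 0 := by
    ext x
    change α x (P.sharp x 0) = 0
    simp
  have h3 : diff (0 : SmoothMap E M ℝ) = 0 := by
    ext x w
    change mvfderiv 𝓘(ℝ, E) (fun _ ↦ (0 : ℝ)) x w = 0
    rw [mvfderiv_const]
    rfl
  rw [BivectorField.formBracket, h1, h2, h3, lieDerivative_zero, lieDerivative_zero_left]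
  simp

theorem formBracket_smulSection (α β : OneForm E M) (f : SmoothMap E M ℝ) :
    P.formBracket α (smulSection f β) =
      smulSection f (P.formBracket α β) + smulSection (dirDeriv (P.sharpForm α) f) β := by
  have h1 : P.sharpForm (smulSection f β) = smulSection f (P.sharpForm β) := by
    ext x
    exact map_smul (P.sharp x) (f x) (β x)
  have h2 : P.eval α (smulSection f β) = f * P.eval α β := rfl
  rw [BivectorField.formBracket, h1, h2, lieDerivative_smulSection, smulSection_lieDerivative,
    diff_mul]
  ext x w
  have := P.skew x (α x) (β x)
  change (f x * lieDerivative (P.sharpForm α) β x w + dirDeriv (P.sharpForm α) f x * β x w)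
    - (f x * lieDerivative (P.sharpForm β) α x w + α x (P.sharp x (β x)) * diff f x w)
    - (f x * diff (P.eval α β) x w + β x (P.sharp x (α x)) * diff f x w)
    = f x * (lieDerivative (P.sharpForm α) β x w - lieDerivative (P.sharpForm β) α x w
      - diff (P.eval α β) x w) + dirDeriv (P.sharpForm α) f x * β x w
  rw [this]
  ring

theorem bracket_forms (α β : OneForm E M) : bracket ρ B P (α, 0) (β, 0) =
    (P.formBracket α β, (1 / 2 : ℝ) • contractForms ρ B α β) := by
  have h : pointwiseLie (0 : SmoothMap E M 𝔤) 0 = 0 := by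
    ext x
    exact lie_zero (0 : 𝔤)
  simp [bracket, actionLie_zero_left, h, dirDeriv_zero]

theorem bracket_const (v w : 𝔤) :
    bracket ρ B P (0, ContMDiffMap.const v) (0, ContMDiffMap.const w) =
      (0, ContMDiffMap.const ⁅v, w⁆) := by
  have h : pointwiseLie (ContMDiffMap.const v : SmoothMap E M 𝔤) (ContMDiffMap.const w) =
    ContMDiffMap.const ⁅v, w⁆ := rfl
  simp [bracket, actionLie_zero, h, dirDeriv_const, formBracket_zero_left,
    contractForms_zero_left]

theorem bracket_const_form (v : 𝔤) (α : OneForm E M) :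
    bracket ρ B P (0, ContMDiffMap.const v) (α, 0) = (lieDerivative (ρ.toFun v) α, 0) := by
  have h : pointwiseLie (ContMDiffMap.const v : SmoothMap E M 𝔤) 0 = 0 := by
    ext x
    exact lie_zero v
  have h' : actionLie ρ (ContMDiffMap.const v) α = lieDerivative (ρ.toFun v) α := rfl
  simp [bracket, actionLie_zero_left, h, h', dirDeriv_const, dirDeriv_zero,
    formBracket_zero_left, contractForms_zero_left]

theorem bracket_leibniz (ξ η : OneForm E M × SmoothMap E M 𝔤) (f : SmoothMap E M ℝ) :
    bracket ρ B P ξ (smulSection f η.1, f • η.2) =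
      (smulSection f (bracket ρ B P ξ η).1, f • (bracket ρ B P ξ η).2) +
      (smulSection (dirDeriv (anchorSection ρ P ξ) f) η.1,
        dirDeriv (anchorSection ρ P ξ) f • η.2) := by
  have h1 : contractForms ρ B ξ.1 (smulSection f η.1) = f • contractForms ρ B ξ.1 η.1 := by
    ext x
    have e : ρ.dualMap x (smulSection f η.1 x) = f x • ρ.dualMap x (η.1 x) := rfl
    change contract _ _ (ρ.dualMap x (smulSection f η.1 x)) = f x • contract _ _ _
    rw [e]
    simp [contract]
  have h2 : pointwiseLie ξ.2 (f • η.2) = f • pointwiseLie ξ.2 η.2 := by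
    ext x
    exact lie_smul (f x) (ξ.2 x) (η.2 x)
  have h3 : dirDeriv (anchorSection ρ P (smulSection f η.1, f • η.2)) ξ.2 =
      f • dirDeriv (anchorSection ρ P η) ξ.2 := by
    ext x
    change mvfderiv 𝓘(ℝ, E) ξ.2 x (P.sharp x (f x • η.1 x) + ρ.toFun (f x • η.2 x) x) =
      f x • mvfderiv 𝓘(ℝ, E) ξ.2 x (P.sharp x (η.1 x) + ρ.toFun (η.2 x) x)
    simp
  refine Prod.ext ?_ ?_
  · change P.formBracket ξ.1 (smulSection f η.1) + actionLie ρ ξ.2 (smulSection f η.1)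
      - actionLie ρ (f • η.2) ξ.1 = _
    rw [formBracket_smulSection]
    ext x w
    change _ + lieDerivative (ρ.toFun (ξ.2 x)) (smulSection f η.1) x w
      - lieDerivative (ρ.toFun (f x • η.2 x)) ξ.1 x w = _
    rw [lieDerivative_smulSection, map_smul, lieDerivative_smul_left]
    change (f x * P.formBracket ξ.1 η.1 x w + mvfderiv 𝓘(ℝ, E) f x (P.sharp x (ξ.1 x)) * η.1 x w)
      + (f x * lieDerivative (ρ.toFun (ξ.2 x)) η.1 x w
        + mvfderiv 𝓘(ℝ, E) f x (ρ.toFun (ξ.2 x) x) * η.1 x w)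
      - f x * lieDerivative (ρ.toFun (η.2 x)) ξ.1 x w =
      f x * (P.formBracket ξ.1 η.1 x w + lieDerivative (ρ.toFun (ξ.2 x)) η.1 x w
        - lieDerivative (ρ.toFun (η.2 x)) ξ.1 x w)
      + mvfderiv 𝓘(ℝ, E) f x (P.sharp x (ξ.1 x) + ρ.toFun (ξ.2 x) x) * η.1 x w
    rw [map_add]
    ring
  · change (1 / 2 : ℝ) • contractForms ρ B ξ.1 (smulSection f η.1) + pointwiseLie ξ.2 (f • η.2)
      + dirDeriv (anchorSection ρ P ξ) (f • η.2)
      - dirDeriv (anchorSection ρ P (smulSection f η.1, f • η.2)) ξ.2 = _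
    rw [h1, h2, h3, dirDeriv_smul]
    ext x
    change (1 / 2 : ℝ) • (f x • contractForms ρ B ξ.1 η.1 x) + f x • pointwiseLie ξ.2 η.2 x
      + (f x • dirDeriv (anchorSection ρ P ξ) η.2 x + dirDeriv (anchorSection ρ P ξ) f x • η.2 x)
      - f x • dirDeriv (anchorSection ρ P η) ξ.2 x =
      f x • ((1 / 2 : ℝ) • contractForms ρ B ξ.1 η.1 x + pointwiseLie ξ.2 η.2 x
      + dirDeriv (anchorSection ρ P ξ) η.2 x - dirDeriv (anchorSection ρ P η) ξ.2 x)
      + dirDeriv (anchorSection ρ P ξ) f x • η.2 x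
    module

theorem InvariantForm.trivector_swap (μ ν : Module.Dual ℝ 𝔤) :
    B.trivector μ ν = -B.trivector ν μ := by
  obtain ⟨u, rfl⟩ := (B.form.toDual B.nondegenerate).surjective μ
  obtain ⟨v, rfl⟩ := (B.form.toDual B.nondegenerate).surjective ν
  ext l
  obtain ⟨w, rfl⟩ := (B.form.toDual B.nondegenerate).surjective l
  have h1 := B.invariant u v w
  have h2 := B.invariant v u w
  have h3 : B.form ⁅u, v⁆ w = -B.form ⁅v, u⁆ w := by
    have h : ⁅u, v⁆ = -⁅v, u⁆ := (lie_skew u v).symm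
    rw [h, map_neg, LinearMap.neg_apply]
  change B.trivector (B.form u) (B.form v) (B.form w) =
    -B.trivector (B.form v) (B.form u) (B.form w)
  rw [B.trivector_apply, B.trivector_apply]
  linarith

theorem bracket_swap (ξ η : OneForm E M × SmoothMap E M 𝔤) :
    bracket ρ B P ξ η = -bracket ρ B P η ξ := by
  refine Prod.ext ?_ ?_
  · have h : P.eval ξ.1 η.1 = (ContMDiffMap.const (-1) : SmoothMap E M ℝ) * P.eval η.1 ξ.1 := by
      ext x
      change η.1 x (P.sharp x (ξ.1 x)) = -1 * ξ.1 x (P.sharp x (η.1 x))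
      rw [P.skew]
      ring
    change P.formBracket ξ.1 η.1 + actionLie ρ ξ.2 η.1 - actionLie ρ η.2 ξ.1 =
      -(P.formBracket η.1 ξ.1 + actionLie ρ η.2 ξ.1 - actionLie ρ ξ.2 η.1)
    have h' : diff (P.eval ξ.1 η.1) = -diff (P.eval η.1 ξ.1) := by
      rw [h, diff_mul]
      ext x w
      change -1 * diff (P.eval η.1 ξ.1) x w
        + P.eval η.1 ξ.1 x * mvfderiv 𝓘(ℝ, E) (fun _ ↦ (-1 : ℝ)) x w =
        -diff (P.eval η.1 ξ.1) x w
      rw [mvfderiv_const]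
      simp
    rw [BivectorField.formBracket, BivectorField.formBracket, h']
    abel
  · have h : contractForms ρ B ξ.1 η.1 = -contractForms ρ B η.1 ξ.1 := by
      ext x
      change contract _ _ _ = -contract _ _ _
      rw [contract, B.trivector_swap, map_neg]
      rfl
    have h' : pointwiseLie ξ.2 η.2 = -pointwiseLie η.2 ξ.2 := by
      ext x
      exact (lie_skew (ξ.2 x) (η.2 x)).symm
    change (1 / 2 : ℝ) • contractForms ρ B ξ.1 η.1 + pointwiseLie ξ.2 η.2
      + dirDeriv (anchorSection ρ P ξ) η.2 - dirDeriv (anchorSection ρ P η) ξ.2 =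
      -((1 / 2 : ℝ) • contractForms ρ B η.1 ξ.1 + pointwiseLie η.2 ξ.2
      + dirDeriv (anchorSection ρ P η) ξ.2 - dirDeriv (anchorSection ρ P ξ) η.2)
    rw [h, h', smul_neg]
    abel

theorem lieDerivative_add (X : SmoothVectorField E M) (α β : OneForm E M) :
    lieDerivative X (α + β) = lieDerivative X α + lieDerivative X β := by
  ext x w
  have hw := FiberBundle.mdifferentiableAt_extend 𝓘(ℝ, E) E w
  change lieDerivative X _ x w = lieDerivative X α x w + lieDerivative X β x w
  rw [lieDerivative_apply, lieDerivative_apply, lieDerivative_apply]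
  have e : (fun y ↦ (α + β) y (FiberBundle.extend E w y)) =
    (fun y ↦ α y (FiberBundle.extend E w y)) + fun y ↦ β y (FiberBundle.extend E w y) := rfl
  have e' (z : TangentSpace 𝓘(ℝ, E) x) : (α + β) x z = α x z + β x z := rfl
  rw [e, e', mvfderiv_add (mdifferentiableAt_pair α hw) (mdifferentiableAt_pair β hw)]
  simp
  ring

theorem diff_add (f g : SmoothMap E M ℝ) : diff (f + g) = diff f + diff g := by
  ext x w
  change mvfderiv 𝓘(ℝ, E) (⇑f + ⇑g) x w = mvfderiv 𝓘(ℝ, E) f x w + mvfderiv 𝓘(ℝ, E) g x w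
  rw [mvfderiv_add f.mdifferentiableAt g.mdifferentiableAt]
  simp

theorem bracket_add_right (ξ η ζ : OneForm E M × SmoothMap E M 𝔤) :
    bracket ρ B P ξ (η + ζ) = bracket ρ B P ξ η + bracket ρ B P ξ ζ := by
  refine Prod.ext ?_ ?_
  · have h1 : P.sharpForm (η.1 + ζ.1) = P.sharpForm η.1 + P.sharpForm ζ.1 := by
      ext x
      exact map_add (P.sharp x) (η.1 x) (ζ.1 x)
    have h2 : P.eval ξ.1 (η.1 + ζ.1) = P.eval ξ.1 η.1 + P.eval ξ.1 ζ.1 := rfl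
    have h3 : actionLie ρ ξ.2 (η.1 + ζ.1) = actionLie ρ ξ.2 η.1 + actionLie ρ ξ.2 ζ.1 := by
      ext x w
      change lieDerivative (ρ.toFun (ξ.2 x)) (η.1 + ζ.1) x w = _
      rw [lieDerivative_add]
      rfl
    have h4 : actionLie ρ (η.2 + ζ.2) ξ.1 = actionLie ρ η.2 ξ.1 + actionLie ρ ζ.2 ξ.1 := by
      ext x w
      change lieDerivative (ρ.toFun (η.2 x + ζ.2 x)) ξ.1 x w = _
      rw [map_add, lieDerivative_add_left]
      rfl
    change P.formBracket ξ.1 (η.1 + ζ.1) + actionLie ρ ξ.2 (η.1 + ζ.1)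
        - actionLie ρ (η.2 + ζ.2) ξ.1 =
      (P.formBracket ξ.1 η.1 + actionLie ρ ξ.2 η.1 - actionLie ρ η.2 ξ.1) +
      (P.formBracket ξ.1 ζ.1 + actionLie ρ ξ.2 ζ.1 - actionLie ρ ζ.2 ξ.1)
    simp only [BivectorField.formBracket]
    rw [h1, h2, h3, h4, lieDerivative_add, lieDerivative_add_left, diff_add]
    abel
  · ext x
    have h1 : contractForms ρ B ξ.1 (η.1 + ζ.1) x =
        contractForms ρ B ξ.1 η.1 x + contractForms ρ B ξ.1 ζ.1 x := by
      have e : ρ.dualMap x ((η.1 + ζ.1) x) = ρ.dualMap x (η.1 x) + ρ.dualMap x (ζ.1 x) := rfl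
      change contract _ _ _ = contract _ _ _ + contract _ _ _
      rw [e]
      simp [contract]
    have h2 : dirDeriv (anchorSection ρ P ξ) (η.2 + ζ.2) x =
        dirDeriv (anchorSection ρ P ξ) η.2 x + dirDeriv (anchorSection ρ P ξ) ζ.2 x := by
      change mvfderiv 𝓘(ℝ, E) (⇑η.2 + ⇑ζ.2) x _ = _
      rw [mvfderiv_add η.2.mdifferentiableAt ζ.2.mdifferentiableAt]
      rfl
    have h3 : dirDeriv (anchorSection ρ P (η + ζ)) ξ.2 x =
        dirDeriv (anchorSection ρ P η) ξ.2 x + dirDeriv (anchorSection ρ P ζ) ξ.2 x := by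
      change mvfderiv 𝓘(ℝ, E) ξ.2 x (P.sharp x (η.1 x + ζ.1 x) + ρ.toFun (η.2 x + ζ.2 x) x) =
        mvfderiv 𝓘(ℝ, E) ξ.2 x (P.sharp x (η.1 x) + ρ.toFun (η.2 x) x) +
        mvfderiv 𝓘(ℝ, E) ξ.2 x (P.sharp x (ζ.1 x) + ρ.toFun (ζ.2 x) x)
      simp
      abel
    change (1 / 2 : ℝ) • contractForms ρ B ξ.1 (η.1 + ζ.1) x + ⁅ξ.2 x, η.2 x + ζ.2 x⁆
      + dirDeriv (anchorSection ρ P ξ) (η.2 + ζ.2) x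
      - dirDeriv (anchorSection ρ P (η + ζ)) ξ.2 x =
      ((1 / 2 : ℝ) • contractForms ρ B ξ.1 η.1 x + ⁅ξ.2 x, η.2 x⁆
      + dirDeriv (anchorSection ρ P ξ) η.2 x - dirDeriv (anchorSection ρ P η) ξ.2 x) +
      ((1 / 2 : ℝ) • contractForms ρ B ξ.1 ζ.1 x + ⁅ξ.2 x, ζ.2 x⁆
      + dirDeriv (anchorSection ρ P ξ) ζ.2 x - dirDeriv (anchorSection ρ P ζ) ξ.2 x)
    rw [h1, h2, h3, lie_add, smul_add]
    abel

/-- The defining properties of the bracket on `Ω¹(M) ⊕ C^∞(M, 𝔤)`: it is skew-symmetric and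
additive, satisfies the Leibniz identity with respect to the anchor `r`, and is prescribed on
1-forms and on constant functions with values in `𝔤`. -/
structure IsLeibnizExtension
    (b : OneForm E M × SmoothMap E M 𝔤 → OneForm E M × SmoothMap E M 𝔤 →
      OneForm E M × SmoothMap E M 𝔤) : Prop where
  swap : ∀ ξ η, b ξ η = -b η ξ
  add_right : ∀ ξ η ζ, b ξ (η + ζ) = b ξ η + b ξ ζ
  leibniz : ∀ ξ η (f : SmoothMap E M ℝ), b ξ (smulSection f η.1, f • η.2) =
    (smulSection f (b ξ η).1, f • (b ξ η).2) +
      (smulSection (dirDeriv (anchorSection ρ P ξ) f) η.1,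
        dirDeriv (anchorSection ρ P ξ) f • η.2)
  forms : ∀ α β : OneForm E M,
    b (α, 0) (β, 0) = (P.formBracket α β, (1 / 2 : ℝ) • contractForms ρ B α β)
  const : ∀ v w : 𝔤, b (0, ContMDiffMap.const v) (0, ContMDiffMap.const w) =
    (0, ContMDiffMap.const ⁅v, w⁆)
  const_form : ∀ (v : 𝔤) (α : OneForm E M),
    b (0, ContMDiffMap.const v) (α, 0) = (lieDerivative (ρ.toFun v) α, 0)

theorem isLeibnizExtension_bracket : IsLeibnizExtension ρ B P (bracket ρ B P) :=
  ⟨bracket_swap ρ B P, bracket_add_right ρ B P, bracket_leibniz ρ B P, bracket_forms ρ B P,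
    bracket_const ρ B P, bracket_const_form ρ B P⟩

/-- The bracket is the only operation with the defining properties. -/
theorem IsLeibnizExtension.eq_bracket
    {b : OneForm E M × SmoothMap E M 𝔤 → OneForm E M × SmoothMap E M 𝔤 →
      OneForm E M × SmoothMap E M 𝔤} (hb : IsLeibnizExtension ρ B P b) : b = bracket ρ B P := by
  have key (ξ : OneForm E M × SmoothMap E M 𝔤)
      (h1 : ∀ α : OneForm E M, b ξ (α, 0) = bracket ρ B P ξ (α, 0))
      (h2 : ∀ v : 𝔤, b ξ (0, ContMDiffMap.const v) = bracket ρ B P ξ (0, ContMDiffMap.const v))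
      (η : OneForm E M × SmoothMap E M 𝔤) : b ξ η = bracket ρ B P ξ η := by
    let D : OneForm E M × SmoothMap E M 𝔤 →+ OneForm E M × SmoothMap E M 𝔤 :=
      AddMonoidHom.mk' (fun η ↦ b ξ η - bracket ρ B P ξ η) fun η ζ ↦ by
        rw [hb.add_right, bracket_add_right]
        abel
    suffices D η = 0 from sub_eq_zero.1 this
    have hη : η = (η.1, 0) + ∑ i, ((0 : OneForm E M), coordMap ((Module.finBasis ℝ 𝔤).coord i) η.2 •
        (ContMDiffMap.const (Module.finBasis ℝ 𝔤 i) : SmoothMap E M 𝔤)) := by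
      refine Prod.ext ?_ ?_
      · simp [Prod.fst_sum]
      · rw [Prod.snd_add, Prod.snd_sum, zero_add]
        ext x
        have := map_sum (ContMDiffMap.coeFnAddMonoidHom (I := 𝓘(ℝ, E)) (N := M) (n := ∞)
          (I' := 𝓘(ℝ, 𝔤)) (G := 𝔤)) (fun i ↦ coordMap ((Module.finBasis ℝ 𝔤).coord i) η.2 •
            (ContMDiffMap.const (Module.finBasis ℝ 𝔤 i) : SmoothMap E M 𝔤)) Finset.univ
        have := congrFun this x
        rw [Finset.sum_apply] at this
        exact ((Module.finBasis ℝ 𝔤).sum_repr (η.2 x)).symm.trans this.symm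
    rw [hη, map_add, map_sum]
    have e1 : D (η.1, 0) = 0 := sub_eq_zero.2 (h1 _)
    have e2 (f : SmoothMap E M ℝ) (v : 𝔤) : D (0, f • ContMDiffMap.const v) = 0 := by
      have e3 : smulSection f (0 : OneForm E M) = 0 := by
        ext x
        exact smul_zero (f x)
      have e4 := hb.leibniz ξ (0, ContMDiffMap.const v) f
      have e5 := bracket_leibniz ρ B P ξ (0, ContMDiffMap.const v) f
      rw [← h2 v] at e5
      rw [← e5] at e4
      simp only [e3] at e4
      exact sub_eq_zero.2 e4
    simp [e1, e2]
  have s1 (α : OneForm E M) : ∀ η, b (α, 0) η = bracket ρ B P (α, 0) η :=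
    key _ (fun β ↦ by rw [hb.forms, bracket_forms]) fun v ↦ by
      rw [hb.swap, hb.const_form, bracket_swap, bracket_const_form]
  have s2 (v : 𝔤) : ∀ η, b (0, ContMDiffMap.const v) η = bracket ρ B P (0, ContMDiffMap.const v) η :=
    key _ (fun β ↦ by rw [hb.const_form, bracket_const_form]) fun w ↦ by
      rw [hb.const, bracket_const]
  funext ξ η
  refine key ξ (fun α ↦ ?_) (fun v ↦ ?_) η
  · rw [hb.swap, s1, ← bracket_swap]
  · rw [hb.swap, s2, ← bracket_swap]

end Action

section Algebroid

variable [IsManifold 𝓘(ℝ, E) ∞ M]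

/-- The vector bundle `V → M` with the bundle map `ρ : V → TM` (the anchor) and the operation
`b` on smooth sections is a Lie algebroid: `ρ` is a smooth morphism of vector bundles, `b` is a Lie
bracket on the real vector space of sections, and the Leibniz identity
`b(ξ, f ξ') = f b(ξ, ξ') + L_{ρ(ξ)}(f) ξ'` holds. -/
structure IsLieAlgebroid {F : Type*} [NormedAddCommGroup F] [NormedSpace ℝ F] {V : M → Type*}
    [TopologicalSpace (TotalSpace F V)] [∀ x, TopologicalSpace (V x)] [FiberBundle F V]
    [∀ x, AddCommGroup (V x)] [∀ x, Module ℝ (V x)] [VectorBundle ℝ F V]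
    (anchor : ∀ x, V x →ₗ[ℝ] TangentSpace 𝓘(ℝ, E) x)
    (b : Cₛ^∞⟮𝓘(ℝ, E); F, V⟯ → Cₛ^∞⟮𝓘(ℝ, E); F, V⟯ → Cₛ^∞⟮𝓘(ℝ, E); F, V⟯) : Prop where
  contMDiff_anchor : ContMDiff (𝓘(ℝ, E).prod 𝓘(ℝ, F)) (𝓘(ℝ, E).prod 𝓘(ℝ, E)) ∞
    (fun p : TotalSpace F V ↦
      (⟨p.1, anchor p.1 p.2⟩ : TotalSpace E (TangentSpace 𝓘(ℝ, E) : M → Type _)))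
  add_left : ∀ ξ η ζ, b (ξ + η) ζ = b ξ ζ + b η ζ
  add_right : ∀ ξ η ζ, b ξ (η + ζ) = b ξ η + b ξ ζ
  smul_left : ∀ (c : ℝ) ξ η, b (c • ξ) η = c • b ξ η
  smul_right : ∀ (c : ℝ) ξ η, b ξ (c • η) = c • b ξ η
  self : ∀ ξ, b ξ ξ = 0
  jacobi : ∀ ξ η ζ, b ξ (b η ζ) + b η (b ζ ξ) + b ζ (b ξ η) = 0
  leibniz : ∀ ξ ξ' (f : SmoothMap E M ℝ) (x : M),
    b ξ (smulSection f ξ') x =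
      f x • b ξ ξ' x + mvfderiv 𝓘(ℝ, E) f x (anchor x (ξ x)) • ξ' x

variable (𝔤 : Type*) [NormedLieAlgebra 𝔤] [FiniteDimensional ℝ 𝔤] [FiniteDimensional ℝ E]

variable (E M) in
/-- Smooth sections of the vector bundle `T*M ⊕ 𝔤`, where `𝔤` denotes the trivial bundle. -/
abbrev SumSection := Cₛ^∞⟮𝓘(ℝ, E); (E →L[ℝ] ℝ) × 𝔤,
  (fun x : M ↦ TangentSpace 𝓘(ℝ, E) x →L[ℝ] ℝ) ×ᵇ Bundle.Trivial M 𝔤⟯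

theorem contMDiff_sumSection {φ : ∀ x : M, TangentSpace 𝓘(ℝ, E) x →L[ℝ] ℝ} {u : M → 𝔤} :
    ContMDiff 𝓘(ℝ, E) (𝓘(ℝ, E).prod 𝓘(ℝ, (E →L[ℝ] ℝ) × 𝔤)) ∞
      (fun x ↦ TotalSpace.mk' ((E →L[ℝ] ℝ) × 𝔤)
        (E := (fun x : M ↦ TangentSpace 𝓘(ℝ, E) x →L[ℝ] ℝ) ×ᵇ Bundle.Trivial M 𝔤)
        x (φ x, u x)) ↔
    ContMDiff 𝓘(ℝ, E) (𝓘(ℝ, E).prod 𝓘(ℝ, E →L[ℝ] ℝ)) ∞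
      (fun x ↦ TotalSpace.mk' (E →L[ℝ] ℝ)
        (E := fun x : M ↦ TangentSpace 𝓘(ℝ, E) x →L[ℝ] ℝ) x (φ x)) ∧
    ContMDiff 𝓘(ℝ, E) 𝓘(ℝ, 𝔤) ∞ u := by
  simp only [ContMDiff, ← forall_and]
  refine forall_congr' fun x ↦ ?_
  rw [contMDiffAt_section, contMDiffAt_section]
  exact contMDiffAt_prod_module_iff _

/-- The identification `Γ(T*M ⊕ 𝔤) = Ω¹(M) ⊕ C^∞(M, 𝔤)`. -/
def sectionEquiv : SumSection E M 𝔤 ≃ OneForm E M × SmoothMap E M 𝔤 where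
  toFun s := (⟨fun x ↦ (s x).1, ((contMDiff_sumSection 𝔤).1 s.contMDiff).1⟩,
    ⟨fun x ↦ (s x).2, ((contMDiff_sumSection 𝔤).1 s.contMDiff).2⟩)
  invFun ξ := ⟨fun x ↦ (ξ.1 x, ξ.2 x),
    (contMDiff_sumSection 𝔤).2 ⟨ξ.1.contMDiff, ξ.2.contMDiff⟩⟩
  left_inv _ := rfl
  right_inv _ := rfl

variable {𝔤} (ρ : InfinitesimalAction 𝔤 E M) (B : InvariantForm 𝔤) (P : BivectorField E M)

/-- The anchor `r : T*M ⊕ 𝔤 → TM`, `r(α, v) = π♯ α + ρ_M(v)`. -/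
def anchor (x : M) : ((fun x : M ↦ TangentSpace 𝓘(ℝ, E) x →L[ℝ] ℝ) ×ᵇ Bundle.Trivial M 𝔤) x →ₗ[ℝ]
    TangentSpace 𝓘(ℝ, E) x where
  toFun a := P.sharp x a.1 + ρ.toFun a.2 x
  map_add' a b := by
    have h : ρ.toFun (a.2 + b.2 : 𝔤) x = ρ.toFun a.2 x + ρ.toFun b.2 x := by
      rw [map_add]
      rfl
    change P.sharp x (a.1 + b.1) + ρ.toFun (a.2 + b.2 : 𝔤) x = _
    rw [h, map_add]
    abel
  map_smul' c a := by
    have h : ρ.toFun (c • a.2 : 𝔤) x = c • ρ.toFun a.2 x := by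
      rw [map_smul]
      rfl
    change P.sharp x (c • a.1) + ρ.toFun (c • a.2 : 𝔤) x = c • (_ + _)
    rw [h, map_smul, smul_add]

/-- The bracket, on sections of `T*M ⊕ 𝔤`. -/
def sumBracket (s t : SumSection E M 𝔤) : SumSection E M 𝔤 :=
  (sectionEquiv 𝔤).symm (bracket ρ B P (sectionEquiv 𝔤 s) (sectionEquiv 𝔤 t))

end Algebroid

end

end QPoisson

namespace QPoisson

set_option linter.unusedSectionVars false

/-! ### Vector fields as derivations, and product rules for vector-valued functions. -/

section DerivationCalculus

variable {E : Type*} [NormedAddCommGroup E] [NormedSpace ℝ E] [FiniteDimensional ℝ E]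
  {M : Type*} [TopologicalSpace M] [ChartedSpace E M] [IsManifold 𝓘(ℝ, E) ∞ M]

/-! Two expressions measure what can go wrong. The anchor defect of `ξ, η` is the vector field `[r
ξ, r η] - r [ξ, η]`, viewed as an operator on functions (`anchorDefect`); the other one is the
Jacobiator (`jacobiator`). By skew-symmetry and the Leibniz identity the anchor defect is tensorial
in `ξ` and `η`. The Jacobiator satisfies `J(ξ, η, f ζ) = f J(ξ, η, ζ) + D(ξ, η)(f) ζ`, where `D` is
the anchor defect, so it is tensorial once `D` vanishes. A tensorial expression is determined by
exact forms `df` and constants `v ∈ 𝔤` (`eq_zero_of_tensorial`).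

Identify `𝔤*` with `𝔤` by the form, and let `μ_f` be the `𝔤`-valued function corresponding to `ρ_M^*
df`, so that `⟨μ_f, v⟩ = ρ_M(v) f`. On generators the anchor defect, applied to `h`, is `{f,{g,h}} +
{g,{h,f}} + {h,{f,g}} - ¼⟨μ_f, [μ_g, μ_h]⟩` for `df, dg`; it is `(L_{ρ_M(v)} π)(df, dh)` for `v,
df`; and it is zero for two constants. The first two are exactly the obstructions in the definition
of a quasi-Poisson structure, whence (i) ⇔ (ii).

For (i) ⇒ (iii) the Jacobiator is computed on generators. With at least two constants it vanishes by
the Jacobi identity in `𝔤` and because `ρ_M` is a homomorphism. With one constant it vanishes by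
invariance of `π`, equivariance of `f ↦ μ_f` and the Jacobi identity in `𝔤`. On three exact forms,
the 1-form component is the differential of the quasi-Poisson identity, and the `𝔤` component
cancels by the formula for `μ_{{f,g}}` (`moment_diff_poisson`).

For (iii) ⇒ (ii), the formula for `J(ξ, η, f df)` gives `D(ξ, η)(f) df = 0`; evaluating on the
vector field `D(ξ, η)` itself gives `(D(ξ, η) f)² = 0`. Finally, every Lie algebroid axiom other
than Jacobi holds for any `π`, so (iii) ⇔ (iv). -/

/-- Chain rule: the pullback applies the inverse of the differential of the inverse chart, and the
two cancel. -/
theorem mvfderiv_extChartAt_symm {f : M → ℝ} {x : M} {e : E}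
    (he : e ∈ (extChartAt 𝓘(ℝ, E) x).target)
    (hf : MDifferentiableAt 𝓘(ℝ, E) 𝓘(ℝ, ℝ) f ((extChartAt 𝓘(ℝ, E) x).symm e))
    (X : ∀ y : M, TangentSpace 𝓘(ℝ, E) y) :
    mvfderiv 𝓘(ℝ, E) f ((extChartAt 𝓘(ℝ, E) x).symm e) (X ((extChartAt 𝓘(ℝ, E) x).symm e)) =
      fderivWithin ℝ (f ∘ (extChartAt 𝓘(ℝ, E) x).symm) (Set.range 𝓘(ℝ, E)) e
        (VectorField.mpullbackWithin 𝓘(ℝ, E) 𝓘(ℝ, E) (extChartAt 𝓘(ℝ, E) x).symm X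
          (Set.range 𝓘(ℝ, E)) e) := by
  have hinv := isInvertible_mfderivWithin_extChartAt_symm (I := 𝓘(ℝ, E)) he
  have hs := mdifferentiableWithinAt_extChartAt_symm (I := 𝓘(ℝ, E)) he
  have h := mvfderiv_comp_mfderivWithin e hf hs
    (𝓘(ℝ, E).uniqueMDiffOn _ ⟨e, rfl⟩)
  have h2 : mvfderivWithin 𝓘(ℝ, E) (f ∘ (extChartAt 𝓘(ℝ, E) x).symm) (Set.range 𝓘(ℝ, E))
      e = fderivWithin ℝ (f ∘ (extChartAt 𝓘(ℝ, E) x).symm)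
        (Set.range 𝓘(ℝ, E)) e := mfderivWithin_eq_fderivWithin
  rw [← h2, h, VectorField.mpullbackWithin_apply]
  exact congrArg _ (hinv.self_apply_inverse _).symm

/-- The bracket of fields is natural under pullback to a chart, where the identity reduces to the
symmetry of the second derivative of `f`. -/
theorem dirDeriv_vfBracket (X Y : SmoothVectorField E M) (f : SmoothMap E M ℝ) :
    dirDeriv (vfBracket X Y) f = dirDeriv X (dirDeriv Y f) - dirDeriv Y (dirDeriv X f) := by
  have hc : CompleteSpace E := FiniteDimensional.complete ℝ E
  have h2 : IsManifold 𝓘(ℝ, E) 2 M := inferInstance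
  have : IsManifold 𝓘(ℝ, E) (minSmoothness ℝ 2) M := isManifold_minSmoothness_two
  ext x
  set φ := extChartAt 𝓘(ℝ, E) x with hφ
  set R := Set.range 𝓘(ℝ, E) with hR
  let pb (Z : SmoothVectorField E M) : E → E :=
    VectorField.mpullbackWithin 𝓘(ℝ, E) 𝓘(ℝ, E) φ.symm Z R
  have hx : φ.symm (φ x) = x := extChartAt_to_inv x
  have key (Z : SmoothVectorField E M) (g : SmoothMap E M ℝ) {e : E} (he : e ∈ φ.target) :
      dirDeriv Z g (φ.symm e) = fderivWithin ℝ (g ∘ φ.symm) R e (pb Z e) :=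
    mvfderiv_extChartAt_symm he g.mdifferentiableAt Z
  have dpb (Z : SmoothVectorField E M) : DifferentiableWithinAt ℝ (pb Z) R (φ x) := by
    have := (Z.mdifferentiableAt (x := x)).mdifferentiableWithinAt
      (s := Set.univ) |>.differentiableWithinAt_mpullbackWithin_vectorField
    rwa [Set.preimage_univ, Set.univ_inter] at this
  have hx' : φ x ∈ φ.target := mem_extChartAt_target x
  have key2 (Z Z' : SmoothVectorField E M) : dirDeriv Z (dirDeriv Z' f) x =
      fderivWithin ℝ (fun e ↦ fderivWithin ℝ (f ∘ φ.symm) R e (pb Z' e)) R (φ x)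
        (pb Z (φ x)) := by
    conv_lhs => rw [← hx]
    rw [key _ _ hx']
    refine congrArg (fun L : E →L[ℝ] ℝ ↦ L (pb Z (φ x))) ?_
    -- The coordinate formula for the inner derivative holds only on the chart target; agreement
    -- near `φ x` is enough to differentiate it again.
    refine Filter.EventuallyEq.fderivWithin_eq_of_mem ?_ ⟨φ x, rfl⟩
    filter_upwards [extChartAt_target_mem_nhdsWithin (I := 𝓘(ℝ, E)) x] with e he
    exact key Z' f he
  have hb : pb (vfBracket X Y) (φ x) = VectorField.lieBracketWithin ℝ (pb X) (pb Y) R (φ x) := by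
    rw [← VectorField.mlieBracketWithin_eq_lieBracketWithin]
    exact VectorField.mpullbackWithin_mlieBracketWithin (n := ∞) (t := Set.univ)
      X.mdifferentiableAt.mdifferentiableWithinAt Y.mdifferentiableAt.mdifferentiableWithinAt
      𝓘(ℝ, E).uniqueMDiffOn (contMDiffWithinAt_extChartAt_symm_range x hx') ⟨φ x, rfl⟩
      (by simpa using ENat.LEInfty.out) (by simp) (by simp [hR])
  have hg : ContDiffWithinAt ℝ ∞ (f ∘ φ.symm) R (φ x) := by
    rw [← contMDiffWithinAt_iff_contDiffWithinAt]
    exact (f.contMDiff _).comp_contMDiffWithinAt _ (contMDiffWithinAt_extChartAt_symm_range x hx')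
  change dirDeriv (vfBracket X Y) f x = dirDeriv X (dirDeriv Y f) x - dirDeriv Y (dirDeriv X f) x
  rw [key2, key2]
  conv_lhs => rw [← hx]
  rw [key _ _ hx', hb]
  refine VectorField.fderivWithin_apply_lieBracket hg (by simpa using ENat.LEInfty.out) ?_ ?_ ?_ (dpb Y) (dpb X)
  · exact 𝓘(ℝ, E).uniqueDiffOn
  · simp [hR]
  · exact ⟨φ x, rfl⟩

theorem mvfderiv_bilinear {W₁ W₂ W₃ : Type*} [NormedAddCommGroup W₁] [NormedSpace ℝ W₁]
    [NormedAddCommGroup W₂] [NormedSpace ℝ W₂] [NormedAddCommGroup W₃] [NormedSpace ℝ W₃]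
    (L : W₁ →L[ℝ] W₂ →L[ℝ] W₃) {u : M → W₁} {v : M → W₂} {x : M}
    (hu : MDifferentiableAt 𝓘(ℝ, E) 𝓘(ℝ, W₁) u x) (hv : MDifferentiableAt 𝓘(ℝ, E) 𝓘(ℝ, W₂) v x)
    (w : TangentSpace 𝓘(ℝ, E) x) :
    mvfderiv 𝓘(ℝ, E) (fun y ↦ L (u y) (v y)) x w =
      L (mvfderiv 𝓘(ℝ, E) u x w) (v x) + L (u x) (mvfderiv 𝓘(ℝ, E) v x w) := by
  have h1 : HasMFDerivAt 𝓘(ℝ, E) 𝓘(ℝ, W₁ × W₂) (fun y ↦ (u y, v y)) x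
      ((mvfderiv 𝓘(ℝ, E) u x).prod (mvfderiv 𝓘(ℝ, E) v x)) :=
    ⟨hu.continuousAt.prodMk hv.continuousAt, hu.hasMFDerivAt.2.prodMk hv.hasMFDerivAt.2⟩
  have h2 := (L.isBoundedBilinearMap.hasFDerivAt (u x, v x)).hasMFDerivAt
  have h3 := (HasMFDerivAt.comp x h2 h1).mfderiv
  have h4 := congrArg (fun T : E →L[ℝ] W₃ ↦ T w) h3
  rw [add_comm]
  exact h4

theorem mvfderiv_linear {W₁ W₂ : Type*} [NormedAddCommGroup W₁] [NormedSpace ℝ W₁]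
    [NormedAddCommGroup W₂] [NormedSpace ℝ W₂]
    (L : W₁ →L[ℝ] W₂) {u : M → W₁} {x : M}
    (hu : MDifferentiableAt 𝓘(ℝ, E) 𝓘(ℝ, W₁) u x) (w : TangentSpace 𝓘(ℝ, E) x) :
    mvfderiv 𝓘(ℝ, E) (fun y ↦ L (u y)) x w = L (mvfderiv 𝓘(ℝ, E) u x w) := by
  have h3 := (HasMFDerivAt.comp x L.hasFDerivAt.hasMFDerivAt hu.hasMFDerivAt).mfderiv
  exact congrArg (fun T : E →L[ℝ] W₂ ↦ T w) h3

theorem dirDeriv_add {W : Type*} [NormedAddCommGroup W] [NormedSpace ℝ W]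
    (X : SmoothVectorField E M) (f g : SmoothMap E M W) :
    dirDeriv X (f + g) = dirDeriv X f + dirDeriv X g := by
  ext x
  change mvfderiv 𝓘(ℝ, E) (⇑f + ⇑g) x (X x) = _
  rw [mvfderiv_add f.mdifferentiableAt g.mdifferentiableAt]
  rfl

theorem dirDeriv_const_smul {W : Type*} [NormedAddCommGroup W] [NormedSpace ℝ W]
    (X : SmoothVectorField E M) (c : ℝ) (f : SmoothMap E M W) :
    dirDeriv X (c • f) = c • dirDeriv X f := by
  ext x
  exact mvfderiv_linear (c • ContinuousLinearMap.id ℝ W) f.mdifferentiableAt (X x)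

theorem dirDeriv_neg {W : Type*} [NormedAddCommGroup W] [NormedSpace ℝ W]
    (X : SmoothVectorField E M) (f : SmoothMap E M W) :
    dirDeriv X (-f) = -dirDeriv X f := by
  rw [← neg_one_smul ℝ f, dirDeriv_const_smul, neg_one_smul]

theorem dirDeriv_mul (X : SmoothVectorField E M) (f g : SmoothMap E M ℝ) :
    dirDeriv X (f * g) = f * dirDeriv X g + dirDeriv X f * g :=
  dirDeriv_smul X f g

theorem dirDeriv_add_left {W : Type*} [NormedAddCommGroup W] [NormedSpace ℝ W]
    (X Y : SmoothVectorField E M) (f : SmoothMap E M W) :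
    dirDeriv (X + Y) f = dirDeriv X f + dirDeriv Y f := by
  ext x
  exact map_add (mvfderiv 𝓘(ℝ, E) f x) (X x) (Y x)

theorem dirDeriv_smulSection_left {W : Type*} [NormedAddCommGroup W] [NormedSpace ℝ W]
    (X : SmoothVectorField E M) (h : SmoothMap E M ℝ) (f : SmoothMap E M W) :
    dirDeriv (smulSection h X) f = h • dirDeriv X f := by
  ext x
  exact map_smul (mvfderiv 𝓘(ℝ, E) f x) (h x) (X x)

/-- The real function `x ↦ ⟨u x, v x⟩`. -/
noncomputable def InvariantForm.pairing {𝔤 : Type*} [NormedLieAlgebra 𝔤] [FiniteDimensional ℝ 𝔤]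
    (B : InvariantForm 𝔤) (u v : SmoothMap E M 𝔤) : SmoothMap E M ℝ :=
  ⟨fun x ↦ B.form (u x) (v x),
    (B.form.toContinuousBilinearMap.contMDiff.comp u.contMDiff).clm_apply v.contMDiff⟩

variable {𝔤 : Type*} [NormedLieAlgebra 𝔤] [FiniteDimensional ℝ 𝔤] (B : InvariantForm 𝔤)

theorem mvfderiv_pairing (u v : SmoothMap E M 𝔤) (x : M) (w : TangentSpace 𝓘(ℝ, E) x) :
    mvfderiv 𝓘(ℝ, E) (B.pairing u v) x w =
      B.form (mvfderiv 𝓘(ℝ, E) u x w) (v x) + B.form (u x) (mvfderiv 𝓘(ℝ, E) v x w) :=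
  mvfderiv_bilinear B.form.toContinuousBilinearMap u.mdifferentiableAt v.mdifferentiableAt w

theorem dirDeriv_pairing (X : SmoothVectorField E M) (u v : SmoothMap E M 𝔤) :
    dirDeriv X (B.pairing u v) =
      B.pairing (dirDeriv X u) v + B.pairing u (dirDeriv X v) := by
  ext x
  exact mvfderiv_pairing B u v x (X x)

theorem mvfderiv_pointwiseLie (u v : SmoothMap E M 𝔤) (x : M) (w : TangentSpace 𝓘(ℝ, E) x) :
    mvfderiv 𝓘(ℝ, E) (pointwiseLie u v) x w =
      ⁅mvfderiv 𝓘(ℝ, E) u x w, v x⁆ + ⁅u x, mvfderiv 𝓘(ℝ, E) v x w⁆ :=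
  mvfderiv_bilinear (LieModule.toEnd ℝ 𝔤 𝔤 : 𝔤 →ₗ[ℝ] 𝔤 →ₗ[ℝ] 𝔤).toContinuousBilinearMap
    u.mdifferentiableAt v.mdifferentiableAt w

theorem dirDeriv_pointwiseLie (X : SmoothVectorField E M) (u v : SmoothMap E M 𝔤) :
    dirDeriv X (pointwiseLie u v) =
      pointwiseLie (dirDeriv X u) v + pointwiseLie u (dirDeriv X v) := by
  ext x
  exact mvfderiv_pointwiseLie u v x (X x)

end DerivationCalculus

/-! ### Bump-function frames and reduction of tensorial expressions to generators. -/

section Localization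

variable {E : Type*} [NormedAddCommGroup E] [NormedSpace ℝ E] [FiniteDimensional ℝ E]
  {M : Type*} [TopologicalSpace M] [T2Space M] [ChartedSpace E M] [IsManifold 𝓘(ℝ, E) ∞ M]

/-- Near any point there are coordinates and coordinate vector fields, extended to `M` after
multiplication by a bump function. -/
theorem exists_local_frame (x : M) : ∃ (ψ : SmoothMap E M ℝ)
    (g : Fin (Module.finrank ℝ E) → SmoothMap E M ℝ)
    (X : Fin (Module.finrank ℝ E) → SmoothVectorField E M), ψ x = 1 ∧
    ∀ (y : M) (w : TangentSpace 𝓘(ℝ, E) y),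
      ψ y • w = ∑ i, diff (g i) y w • X i y := by
  let b := Module.finBasis ℝ E
  let e := trivializationAt E (TangentSpace 𝓘(ℝ, E) : M → Type _) x
  let φ := extChartAt 𝓘(ℝ, E) x
  obtain ⟨ψ₀⟩ : Nonempty (SmoothBumpFunction 𝓘(ℝ, E) x) := inferInstance
  -- Two nested bump functions: `ψ₀` extends the coordinates, `ψ₁` the coordinate fields. The
  -- support of `ψ₁` lies where `ψ₀` is locally `1`, so cutting off the coordinates does not change
  -- their differentials there, and the frame identity holds on all of `M`.
  have h1 : interior {y | ψ₀ y = 1} ∩ (chartAt E x).source ∈ nhds x :=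
    Filter.inter_mem (interior_mem_nhds.2 ψ₀.eventuallyEq_one)
      ((chartAt E x).open_source.mem_nhds (mem_chart_source E x))
  obtain ⟨ψ₁, -, hψ₁⟩ := (SmoothBumpFunction.nhds_basis_tsupport (I := 𝓘(ℝ, E)) x).mem_iff.1 h1
  have hbase : e.baseSet = (chartAt E x).source := rfl
  have hs (v : E) : ContMDiffOn 𝓘(ℝ, E) (𝓘(ℝ, E).prod 𝓘(ℝ, E)) ∞
      (fun y ↦ TotalSpace.mk' E (E := fun y : M ↦ TangentSpace 𝓘(ℝ, E) y) y (e.symmL ℝ y v))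
      (chartAt E x).source := by
    intro y hy
    have h : ContMDiffAt 𝓘(ℝ, E) (𝓘(ℝ, E).prod 𝓘(ℝ, E)) ∞
        (fun y ↦ TotalSpace.mk' E (E := Trivial M E) y v) y :=
      (contMDiffAt_section _).2 contMDiffAt_const
    exact ((e.contMDiffAt_symmL (IB := 𝓘(ℝ, E)) (n := ∞) hy).clm_bundle_apply
      h).contMDiffWithinAt
  let X (i : Fin (Module.finrank ℝ E)) : SmoothVectorField E M :=
    ⟨fun y ↦ ψ₁ y • e.symmL ℝ y (b i),
      (ψ₁.contMDiff.contMDiffOn).smul_section_of_tsupport (chartAt E x).open_source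
        (hψ₁.trans Set.inter_subset_right) (hs (b i))⟩
  have hΦ : ContMDiff 𝓘(ℝ, E) 𝓘(ℝ, E) ∞ (fun y ↦ ψ₀ y • φ y) :=
    ψ₀.contMDiff_smul contMDiffOn_extChartAt
  let g (i : Fin (Module.finrank ℝ E)) : SmoothMap E M ℝ :=
    ⟨fun y ↦ LinearMap.toContinuousLinearMap (b.coord i) (ψ₀ y • φ y),
      (LinearMap.toContinuousLinearMap (b.coord i)).contMDiff.comp hΦ⟩
  refine ⟨⟨ψ₁, ψ₁.contMDiff⟩, g, X, ψ₁.eq_one, fun y w ↦ ?_⟩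
  change ψ₁ y • w = ∑ i, mvfderiv 𝓘(ℝ, E) (g i) y w • (ψ₁ y • e.symmL ℝ y (b i))
  by_cases hy : ψ₁ y = 0
  · simp [hy]
  have hy' := hψ₁ (subset_tsupport _ hy)
  have hg (i) : mvfderiv 𝓘(ℝ, E) (g i) y w = b.coord i (mfderiv 𝓘(ℝ, E) 𝓘(ℝ, E) φ y w) := by
    have hφ : MDifferentiableAt 𝓘(ℝ, E) 𝓘(ℝ, E) φ y := mdifferentiableAt_extChartAt hy'.2
    have h : ⇑(g i) =ᶠ[nhds y] fun y ↦ LinearMap.toContinuousLinearMap (b.coord i) (φ y) := by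
      filter_upwards [mem_interior_iff_mem_nhds.1 hy'.1] with z hz
      change LinearMap.toContinuousLinearMap (b.coord i) (ψ₀ z • φ z) = _
      rw [show ψ₀ z = 1 from hz, one_smul]
    have h' : mvfderiv 𝓘(ℝ, E) (g i) y w = mvfderiv 𝓘(ℝ, E)
        (fun y ↦ LinearMap.toContinuousLinearMap (b.coord i) (φ y)) y w :=
      congrArg (fun T : E →L[ℝ] ℝ ↦ T w) h.mfderiv_eq
    rw [h', mvfderiv_linear _ hφ]
    rfl
  -- The tangent bundle is trivialized over the chart domain by the differential of the chart.
  have hw : e.symmL ℝ y (mfderiv 𝓘(ℝ, E) 𝓘(ℝ, E) φ y w) = w := by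
    rw [← TangentBundle.continuousLinearMapAt_trivializationAt hy'.2]
    exact e.symmL_continuousLinearMapAt hy'.2 w
  conv_lhs => rw [← hw, ← b.sum_repr (mfderiv 𝓘(ℝ, E) 𝓘(ℝ, E) φ y w)]
  rw [map_sum, Finset.smul_sum]
  refine Finset.sum_congr rfl fun i _ ↦ ?_
  rw [hg, map_smul, smul_comm]
  rfl

theorem exists_vectorField_apply_eq (x : M) (w : TangentSpace 𝓘(ℝ, E) x) :
    ∃ X : SmoothVectorField E M, X x = w := by
  obtain ⟨ψ, g, X, hψ, h⟩ := exists_local_frame (E := E) x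
  refine ⟨∑ i, diff (g i) x w • X i, ?_⟩
  have := h x w
  rw [hψ, one_smul] at this
  rw [section_sum_apply]
  exact this.symm

theorem tangent_eq_zero {x : M} {w : TangentSpace 𝓘(ℝ, E) x}
    (h : ∀ f : SmoothMap E M ℝ, diff f x w = 0) : w = 0 := by
  obtain ⟨ψ, g, X, hψ, hX⟩ := exists_local_frame (E := E) x
  have := hX x w
  rw [hψ, one_smul] at this
  simpa [h] using this

theorem SmoothVectorField.ext_dirDeriv {X Y : SmoothVectorField E M}
    (h : ∀ f : SmoothMap E M ℝ, dirDeriv X f = dirDeriv Y f) : X = Y := by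
  ext x
  refine sub_eq_zero.1 (tangent_eq_zero fun f ↦ ?_)
  have := congrArg (fun g : SmoothMap E M ℝ ↦ g x) (h f)
  rw [map_sub]
  exact sub_eq_zero.2 this

theorem OneForm.ext_pair {α β : OneForm E M}
    (h : ∀ X : SmoothVectorField E M, pair α X = pair β X) : α = β := by
  ext x w
  obtain ⟨X, rfl⟩ := exists_vectorField_apply_eq x w
  exact congrArg (fun g : SmoothMap E M ℝ ↦ g x) (h X)

variable {𝔤 : Type*} [NormedLieAlgebra 𝔤] [FiniteDimensional ℝ 𝔤]

/-- The product of a section of `T*M ⊕ 𝔤` with a function. -/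
noncomputable def sumSMul (f : SmoothMap E M ℝ) (ξ : OneForm E M × SmoothMap E M 𝔤) :
    OneForm E M × SmoothMap E M 𝔤 :=
  (smulSection f ξ.1, f • ξ.2)

/-- An additive map on sections of `T*M ⊕ 𝔤` which is tensorial at a point vanishes as soon as it
vanishes on exact 1-forms and on constant functions. -/
theorem eq_zero_of_tensorial {W : Type*} [AddCommGroup W] [Module ℝ W] {x : M}
    (T : OneForm E M × SmoothMap E M 𝔤 →+ W)
    (hT : ∀ (f : SmoothMap E M ℝ) ξ, T (sumSMul f ξ) = f x • T ξ)
    (hd : ∀ f, T (diff f, 0) = 0) (hc : ∀ v, T (0, ContMDiffMap.const v) = 0)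
    (ξ : OneForm E M × SmoothMap E M 𝔤) : T ξ = 0 := by
  obtain ⟨ψ, g, X, hψ, hX⟩ := exists_local_frame (E := E) x
  -- Applying `ξ.1` to the frame identity gives `ψ ξ.1 = ∑ ξ.1(X i) d(g i)`. This decomposition is
  -- global, so no locality of `T` is needed; as `ψ x = 1`, multiplying by `ψ` does not change the
  -- value of `T`.
  have h1 : sumSMul ψ ξ = ∑ i, sumSMul (pair ξ.1 (X i)) (diff (g i), (0 : SmoothMap E M 𝔤)) +
      ∑ i, sumSMul (ψ * coordMap ((Module.finBasis ℝ 𝔤).coord i) ξ.2)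
        ((0 : OneForm E M), ContMDiffMap.const (Module.finBasis ℝ 𝔤 i)) := by
    refine Prod.ext ?_ ?_
    · rw [Prod.fst_add, Prod.fst_sum, Prod.fst_sum]
      have e (f : SmoothMap E M ℝ) : smulSection f (0 : OneForm E M) = 0 := by
        ext y
        exact smul_zero (f y)
      simp only [sumSMul, e, Finset.sum_const_zero, add_zero]
      ext y w
      have := congrArg (ξ.1 y) (hX y w)
      rw [map_smul, map_sum] at this
      rw [section_sum_apply]
      refine this.trans ?_
      rw [sum_apply]
      refine Finset.sum_congr rfl fun i _ ↦ ?_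
      rw [map_smul, smul_eq_mul, mul_comm]
      rfl
    · rw [Prod.snd_add, Prod.snd_sum, Prod.snd_sum]
      simp only [sumSMul, smul_zero, Finset.sum_const_zero, zero_add]
      ext y
      have := map_sum (ContMDiffMap.coeFnAddMonoidHom (I := 𝓘(ℝ, E)) (N := M) (n := ∞)
          (I' := 𝓘(ℝ, 𝔤)) (G := 𝔤)) (fun i ↦ (ψ * coordMap ((Module.finBasis ℝ 𝔤).coord i) ξ.2) •
            (ContMDiffMap.const (Module.finBasis ℝ 𝔤 i) : SmoothMap E M 𝔤)) Finset.univ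
      have := congrFun this y
      rw [Finset.sum_apply] at this
      refine Eq.trans ?_ this.symm
      change ψ y • ξ.2 y = ∑ i, (ψ y * (Module.finBasis ℝ 𝔤).repr (ξ.2 y) i) •
        (Module.finBasis ℝ 𝔤 i)
      conv_lhs => rw [← (Module.finBasis ℝ 𝔤).sum_repr (ξ.2 y), Finset.smul_sum]
      simp [mul_smul]
  have h2 := hT ψ ξ
  rw [hψ, one_smul, h1, map_add, map_sum, map_sum] at h2
  rw [← h2]
  simp [hT, hd, hc]

end Localization

/-! ### Lie derivatives and brackets of exact 1-forms. -/

section ExactForms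

variable {E : Type*} [NormedAddCommGroup E] [NormedSpace ℝ E] [FiniteDimensional ℝ E]
  {M : Type*} [TopologicalSpace M] [T2Space M] [ChartedSpace E M] [IsManifold 𝓘(ℝ, E) ∞ M]
  (P : BivectorField E M)

theorem pair_diff (f : SmoothMap E M ℝ) (X : SmoothVectorField E M) :
    pair (diff f) X = dirDeriv X f := rfl

theorem lieDerivative_diff (X : SmoothVectorField E M) (f : SmoothMap E M ℝ) :
    lieDerivative X (diff f) = diff (dirDeriv X f) := by
  refine OneForm.ext_pair fun Y ↦ ?_
  rw [pair_lieDerivative, pair_diff, pair_diff, pair_diff, dirDeriv_vfBracket]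
  abel

theorem diff_neg (f : SmoothMap E M ℝ) : diff (-f) = -diff f :=
  OneForm.ext_pair fun Y ↦ dirDeriv_neg Y f

theorem diff_const_smul (c : ℝ) (f : SmoothMap E M ℝ) : diff (c • f) = c • diff f :=
  OneForm.ext_pair fun Y ↦ dirDeriv_const_smul Y c f

theorem dirDeriv_sharpForm_diff (f g : SmoothMap E M ℝ) :
    dirDeriv (P.sharpForm (diff f)) g = P.poisson f g := rfl

theorem BivectorField.poisson_swap (f g : SmoothMap E M ℝ) : P.poisson f g = -P.poisson g f := by
  ext x
  exact P.skew x (diff f x) (diff g x)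

/-- The two Lie derivatives are `d{f,g}` and `d{g,f} = -d{f,g}`, so the three terms add up to `(1 +
1 - 1) d{f,g}`. -/
theorem BivectorField.formBracket_diff (f g : SmoothMap E M ℝ) :
    P.formBracket (diff f) (diff g) = diff (P.poisson f g) := by
  have h : P.eval (diff f) (diff g) = P.poisson f g := rfl
  rw [formBracket, lieDerivative_diff, lieDerivative_diff, h, dirDeriv_sharpForm_diff,
    dirDeriv_sharpForm_diff, P.poisson_swap g f, diff_neg]
  abel

end ExactForms

/-! ### The function `ρ_M^* α` read in `𝔤` through the invariant form. -/

section Moment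

variable {E : Type*} [NormedAddCommGroup E] [NormedSpace ℝ E] [FiniteDimensional ℝ E]
  {M : Type*} [TopologicalSpace M] [T2Space M] [ChartedSpace E M] [IsManifold 𝓘(ℝ, E) ∞ M]
  {𝔤 : Type*} [NormedLieAlgebra 𝔤] [FiniteDimensional ℝ 𝔤]

theorem InvariantForm.eq_of_form_eq (B : InvariantForm 𝔤) {u v : 𝔤}
    (h : ∀ w, B.form u w = B.form v w) : u = v :=
  (B.form.toDual B.nondegenerate).injective (LinearMap.ext h)

theorem InvariantForm.form_lie (B : InvariantForm 𝔤) (u v w : 𝔤) :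
    B.form u ⁅v, w⁆ = B.form ⁅u, v⁆ w := by
  have h1 := B.invariant v u w
  have h2 : B.form ⁅v, u⁆ w = -B.form ⁅u, v⁆ w := by
    rw [← lie_skew u v, map_neg, LinearMap.neg_apply, neg_neg]
  linarith

theorem InvariantForm.form_comm (B : InvariantForm 𝔤) (u v : 𝔤) : B.form u v = B.form v u :=
  B.symm.eq u v

/-- Replaces the trivector by the Lie bracket. Together with the factor `½` in front of the
contraction in `bracket`, this produces the constant `¼` found below. -/
theorem InvariantForm.contract_trivector (B : InvariantForm 𝔤) (u v : 𝔤) :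
    contract B.trivector (B.form u) (B.form v) = (1 / 2 : ℝ) • ⁅u, v⁆ := by
  rw [contract, LinearEquiv.symm_apply_eq]
  ext l
  obtain ⟨w, rfl⟩ := (B.form.toDual B.nondegenerate).surjective l
  change B.trivector (B.form u) (B.form v) (B.form w) = B.form w ((1 / 2 : ℝ) • ⁅u, v⁆)
  rw [B.trivector_apply, B.form_lie, map_smul, B.form_comm, smul_eq_mul]

variable (ρ : InfinitesimalAction 𝔤 E M) (B : InvariantForm 𝔤) (P : BivectorField E M)

/-- The smooth function `ρ_M^* α` with values in `𝔤* ≅ 𝔤`. -/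
noncomputable def moment (α : OneForm E M) : SmoothMap E M 𝔤 :=
  ⟨fun x ↦ (B.form.toDual B.nondegenerate).symm (ρ.dualMap x (α x)), by
    have h : (fun x ↦ (B.form.toDual B.nondegenerate).symm (ρ.dualMap x (α x))) =
        fun x ↦ ∑ j, pair α (ρ.toFun (Module.finBasis ℝ 𝔤 j)) x •
          (B.form.toDual B.nondegenerate).symm ((Module.finBasis ℝ 𝔤).coord j) := by
      funext x
      conv_lhs => rw [← (Module.finBasis ℝ 𝔤).sum_dual_apply_smul_coord (ρ.dualMap x (α x))]
      simp only [map_sum, map_smul]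
      rfl
    rw [h]
    exact fun x ↦ contMDiffAt_finsum_aux _ fun j ↦ ((pair α _).contMDiff x).smul
      contMDiffAt_const⟩

theorem form_moment (α : OneForm E M) (x : M) :
    B.form (moment ρ B α x) = ρ.dualMap x (α x) :=
  (B.form.toDual B.nondegenerate).apply_symm_apply _

/-- The characterization of `moment` used throughout: identities between moments are tested against
constants, where they become identities between derivatives along the action. -/
theorem pairing_moment_diff_const (f : SmoothMap E M ℝ) (v : 𝔤) :
    B.pairing (moment ρ B (diff f)) (ContMDiffMap.const v) = dirDeriv (ρ.toFun v) f := by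
  ext x
  exact LinearMap.congr_fun (form_moment ρ B (diff f) x) v

theorem contractForms_eq (α β : OneForm E M) : contractForms ρ B α β =
    (1 / 2 : ℝ) • pointwiseLie (moment ρ B α) (moment ρ B β) := by
  ext x
  change contract B.trivector (ρ.dualMap x (α x)) (ρ.dualMap x (β x)) = _
  rw [← form_moment ρ B, ← form_moment ρ B, B.contract_trivector]
  rfl

theorem trivector_dualMap (α β γ : OneForm E M) (x : M) :
    B.trivector (ρ.dualMap x (α x)) (ρ.dualMap x (β x)) (ρ.dualMap x (γ x)) =
      (1 / 2) * B.form (moment ρ B α x) ⁅moment ρ B β x, moment ρ B γ x⁆ := by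
  rw [← form_moment ρ B, ← form_moment ρ B, ← form_moment ρ B, B.trivector_apply]

theorem SmoothMap.eq_of_pairing_eq {u v : SmoothMap E M 𝔤}
    (h : ∀ w : 𝔤, B.pairing u (ContMDiffMap.const w) = B.pairing v (ContMDiffMap.const w)) :
    u = v := by
  ext x
  exact B.eq_of_form_eq fun w ↦ congrArg (fun g : SmoothMap E M ℝ ↦ g x) (h w)

theorem dirDeriv_pairing_const (X : SmoothVectorField E M) (u : SmoothMap E M 𝔤) (v : 𝔤) :
    dirDeriv X (B.pairing u (ContMDiffMap.const v)) =
      B.pairing (dirDeriv X u) (ContMDiffMap.const v) := by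
  rw [dirDeriv_pairing, dirDeriv_const]
  ext x
  change _ + B.form (u x) 0 = _
  rw [map_zero, add_zero]

theorem dirDeriv_action_lie (v w : 𝔤) (f : SmoothMap E M ℝ) :
    dirDeriv (ρ.toFun ⁅v, w⁆) f = dirDeriv (ρ.toFun v) (dirDeriv (ρ.toFun w) f)
      - dirDeriv (ρ.toFun w) (dirDeriv (ρ.toFun v) f) := by
  rw [ρ.map_lie, dirDeriv_vfBracket]

/-- Infinitesimal equivariance of `f ↦ μ_f`. Paired with `w`, it is `w(v f) = v(w f) - [v, w] f`,
the homomorphism property of the action. -/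
theorem moment_diff_dirDeriv (v : 𝔤) (f : SmoothMap E M ℝ) :
    moment ρ B (diff (dirDeriv (ρ.toFun v) f)) =
      dirDeriv (ρ.toFun v) (moment ρ B (diff f))
        - pointwiseLie (moment ρ B (diff f)) (ContMDiffMap.const v) := by
  refine SmoothMap.eq_of_pairing_eq B fun w ↦ ?_
  have h1 : B.pairing (dirDeriv (ρ.toFun v) (moment ρ B (diff f))
        - pointwiseLie (moment ρ B (diff f)) (ContMDiffMap.const v)) (ContMDiffMap.const w) =
      B.pairing (dirDeriv (ρ.toFun v) (moment ρ B (diff f))) (ContMDiffMap.const w) -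
      B.pairing (moment ρ B (diff f)) (ContMDiffMap.const ⁅v, w⁆) := by
    ext x
    change B.form (_ - ⁅moment ρ B (diff f) x, v⁆) w =
      B.form _ w - B.form (moment ρ B (diff f) x) ⁅v, w⁆
    rw [B.form_lie, map_sub]
    rfl
  rw [h1, ← dirDeriv_pairing_const, pairing_moment_diff_const, pairing_moment_diff_const,
    pairing_moment_diff_const, dirDeriv_action_lie]
  abel

end Moment

/-! ### The anchor defect, and its equivalence with the quasi-Poisson conditions. -/

section AnchorCalculus

variable {E : Type*} [NormedAddCommGroup E] [NormedSpace ℝ E] [FiniteDimensional ℝ E]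
  {M : Type*} [TopologicalSpace M] [T2Space M] [ChartedSpace E M] [IsManifold 𝓘(ℝ, E) ∞ M]
  {𝔤 : Type*} [NormedLieAlgebra 𝔤] [FiniteDimensional ℝ 𝔤]
  (ρ : InfinitesimalAction 𝔤 E M) (B : InvariantForm 𝔤) (P : BivectorField E M)

theorem anchorSection_add (ξ η : OneForm E M × SmoothMap E M 𝔤) :
    anchorSection ρ P (ξ + η) = anchorSection ρ P ξ + anchorSection ρ P η := by
  ext x
  exact map_add (anchor ρ P x) (ξ.1 x, ξ.2 x) (η.1 x, η.2 x)

theorem anchorSection_sumSMul (f : SmoothMap E M ℝ) (ξ : OneForm E M × SmoothMap E M 𝔤) :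
    anchorSection ρ P (sumSMul f ξ) = smulSection f (anchorSection ρ P ξ) := by
  ext x
  exact map_smul (anchor ρ P x) (f x) (ξ.1 x, ξ.2 x)

theorem anchorSection_form (α : OneForm E M) :
    anchorSection ρ P (α, 0) = P.sharpForm α := by
  ext x
  change P.sharp x (α x) + ρ.toFun 0 x = P.sharp x (α x)
  rw [map_zero]
  exact add_zero _

theorem anchorSection_const (v : 𝔤) :
    anchorSection ρ P (0, ContMDiffMap.const v) = ρ.toFun v := by
  ext x
  change P.sharp x 0 + ρ.toFun v x = ρ.toFun v x
  rw [map_zero, zero_add]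

theorem dirDeriv_anchorSection_diff (f : SmoothMap E M ℝ) (u : SmoothMap E M 𝔤)
    (h : SmoothMap E M ℝ) : dirDeriv (anchorSection ρ P (diff f, u)) h =
      P.poisson f h + B.pairing (moment ρ B (diff h)) u := by
  ext x
  change mvfderiv 𝓘(ℝ, E) h x (P.sharp x (diff f x) + ρ.toFun (u x) x) =
    mvfderiv 𝓘(ℝ, E) h x (P.sharp x (diff f x)) + B.form (moment ρ B (diff h) x) (u x)
  rw [map_add, form_moment]
  rfl

theorem bracket_sumSMul (ξ η : OneForm E M × SmoothMap E M 𝔤) (f : SmoothMap E M ℝ) :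
    bracket ρ B P ξ (sumSMul f η) = sumSMul f (bracket ρ B P ξ η) +
      sumSMul (dirDeriv (anchorSection ρ P ξ) f) η :=
  bracket_leibniz ρ B P ξ η f

theorem bracket_diff_diff (f g : SmoothMap E M ℝ) :
    bracket ρ B P (diff f, 0) (diff g, 0) = (diff (P.poisson f g),
      (1 / 4 : ℝ) • pointwiseLie (moment ρ B (diff f)) (moment ρ B (diff g))) := by
  rw [bracket_forms, contractForms_eq, P.formBracket_diff, smul_smul]
  norm_num

theorem bracket_const_diff (v : 𝔤) (f : SmoothMap E M ℝ) :
    bracket ρ B P (0, ContMDiffMap.const v) (diff f, 0) =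
      (diff (dirDeriv (ρ.toFun v) f), 0) := by
  rw [bracket_const_form, lieDerivative_diff]

/-- The failure of the anchor to preserve brackets, as an operator on functions. -/
noncomputable def anchorDefect (ξ η : OneForm E M × SmoothMap E M 𝔤) (h : SmoothMap E M ℝ) :
    SmoothMap E M ℝ :=
  dirDeriv (anchorSection ρ P ξ) (dirDeriv (anchorSection ρ P η) h)
    - dirDeriv (anchorSection ρ P η) (dirDeriv (anchorSection ρ P ξ) h)
    - dirDeriv (anchorSection ρ P (bracket ρ B P ξ η)) h

theorem anchorSection_bracket_iff (ξ η : OneForm E M × SmoothMap E M 𝔤) :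
    anchorSection ρ P (bracket ρ B P ξ η) =
        vfBracket (anchorSection ρ P ξ) (anchorSection ρ P η) ↔
      ∀ h, anchorDefect ρ B P ξ η h = 0 := by
  constructor
  · intro e h
    rw [anchorDefect, e, dirDeriv_vfBracket, sub_self]
  · intro e
    refine SmoothVectorField.ext_dirDeriv fun h ↦ ?_
    rw [dirDeriv_vfBracket]
    exact (sub_eq_zero.1 (e h)).symm

theorem anchorDefect_swap (ξ η : OneForm E M × SmoothMap E M 𝔤) (h : SmoothMap E M ℝ) :
    anchorDefect ρ B P ξ η h = -anchorDefect ρ B P η ξ h := by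
  have e : dirDeriv (anchorSection ρ P (-bracket ρ B P η ξ)) h =
      -dirDeriv (anchorSection ρ P (bracket ρ B P η ξ)) h := by
    rw [eq_neg_iff_add_eq_zero, ← dirDeriv_add_left, ← anchorSection_add, neg_add_cancel]
    -- The derivative along `r(0)` equals its own double, hence is zero.
    have := dirDeriv_add_left (anchorSection ρ P (0 : OneForm E M × SmoothMap E M 𝔤))
      (anchorSection ρ P 0) h
    rw [← anchorSection_add, add_zero] at this
    exact left_eq_add.1 this
  rw [anchorDefect, anchorDefect, bracket_swap, e]
  abel

theorem anchorDefect_add (ξ η ζ : OneForm E M × SmoothMap E M 𝔤) (h : SmoothMap E M ℝ) :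
    anchorDefect ρ B P ξ (η + ζ) h = anchorDefect ρ B P ξ η h + anchorDefect ρ B P ξ ζ h := by
  simp only [anchorDefect, bracket_add_right, anchorSection_add, dirDeriv_add_left, dirDeriv_add]
  abel

/-- The term `(r(ξ) f) (r(η) h)` arises both from the commutator of derivations and from the Leibniz
identity of the bracket, and cancels. -/
theorem anchorDefect_sumSMul (ξ η : OneForm E M × SmoothMap E M 𝔤) (f h : SmoothMap E M ℝ) :
    anchorDefect ρ B P ξ (sumSMul f η) h = f * anchorDefect ρ B P ξ η h := by
  simp only [anchorDefect, bracket_sumSMul, anchorSection_add, anchorSection_sumSMul,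
    dirDeriv_add_left, dirDeriv_smulSection_left, smul_eq_mul]
  rw [dirDeriv_mul]
  ring

theorem anchorDefect_eq_zero_right {ξ : OneForm E M × SmoothMap E M 𝔤} {h : SmoothMap E M ℝ}
    (hd : ∀ f, anchorDefect ρ B P ξ (diff f, 0) h = 0)
    (hc : ∀ v, anchorDefect ρ B P ξ (0, ContMDiffMap.const v) h = 0)
    (η : OneForm E M × SmoothMap E M 𝔤) : anchorDefect ρ B P ξ η h = 0 := by
  ext x
  let T : OneForm E M × SmoothMap E M 𝔤 →+ ℝ :=
    AddMonoidHom.mk' (fun η ↦ anchorDefect ρ B P ξ η h x) fun η ζ ↦ by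
      rw [anchorDefect_add]
      rfl
  refine eq_zero_of_tensorial T (x := x) (fun f η ↦ ?_) (fun f ↦ ?_) (fun v ↦ ?_) η
  · change anchorDefect ρ B P ξ (sumSMul f η) h x = _
    rw [anchorDefect_sumSMul]
    rfl
  · exact congrArg (fun g : SmoothMap E M ℝ ↦ g x) (hd f)
  · exact congrArg (fun g : SmoothMap E M ℝ ↦ g x) (hc v)

/-- Since `[df, dg]` has 1-form part `d{f,g}`, that part yields the Jacobiator of `{·,·}`; its `𝔤`
part `¼[μ_f, μ_g]` acts on `h` by pairing with `μ_h`, and invariance of the form permutes the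
entries cyclically. -/
theorem anchorDefect_diff_diff (f g h : SmoothMap E M ℝ) :
    anchorDefect ρ B P (diff f, 0) (diff g, 0) h =
      P.poisson f (P.poisson g h) + P.poisson g (P.poisson h f) + P.poisson h (P.poisson f g)
        - (1 / 4 : ℝ) • B.pairing (moment ρ B (diff f))
          (pointwiseLie (moment ρ B (diff g)) (moment ρ B (diff h))) := by
  have e : B.pairing (moment ρ B (diff h))
      ((1 / 4 : ℝ) • pointwiseLie (moment ρ B (diff f)) (moment ρ B (diff g))) =
      (1 / 4 : ℝ) • B.pairing (moment ρ B (diff f))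
          (pointwiseLie (moment ρ B (diff g)) (moment ρ B (diff h))) := by
    ext x
    change B.form (moment ρ B (diff h) x) ((1 / 4 : ℝ) • ⁅_, _⁆) = (1 / 4 : ℝ) * B.form _ ⁅_, _⁆
    rw [map_smul, B.form_lie (moment ρ B (diff f) x), B.form_comm, smul_eq_mul]
  have e' : P.poisson g (P.poisson f h) = -P.poisson g (P.poisson h f) := by
    rw [P.poisson_swap f h, ← dirDeriv_sharpForm_diff, dirDeriv_neg]
    rfl
  rw [anchorDefect, anchorSection_form, anchorSection_form, bracket_diff_diff,
    dirDeriv_anchorSection_diff ρ B, e, dirDeriv_sharpForm_diff, dirDeriv_sharpForm_diff,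
    dirDeriv_sharpForm_diff, dirDeriv_sharpForm_diff, e', P.poisson_swap (P.poisson f g) h]
  abel

theorem anchorDefect_const_diff (v : 𝔤) (f h : SmoothMap E M ℝ) :
    anchorDefect ρ B P (0, ContMDiffMap.const v) (diff f, 0) h =
      dirDeriv (ρ.toFun v) (P.poisson f h) - P.poisson (dirDeriv (ρ.toFun v) f) h
        - P.poisson f (dirDeriv (ρ.toFun v) h) := by
  rw [anchorDefect, bracket_const_diff, anchorSection_const, anchorSection_form,
    anchorSection_form, dirDeriv_sharpForm_diff, dirDeriv_sharpForm_diff, dirDeriv_sharpForm_diff]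
  abel

theorem anchorDefect_const_const (v w : 𝔤) (h : SmoothMap E M ℝ) :
    anchorDefect ρ B P (0, ContMDiffMap.const v) (0, ContMDiffMap.const w) h = 0 := by
  rw [anchorDefect, bracket_const, anchorSection_const, anchorSection_const, anchorSection_const,
    dirDeriv_action_lie, sub_self]

theorem lieDeriv_diff_diff (X : SmoothVectorField E M) (f h : SmoothMap E M ℝ) :
    P.lieDeriv X (diff f) (diff h) = dirDeriv X (P.poisson f h) - P.poisson (dirDeriv X f) h
        - P.poisson f (dirDeriv X h) := by
  rw [BivectorField.lieDeriv, lieDerivative_diff, lieDerivative_diff]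
  rfl

/-- Normalization: `χ_π` is twice the cyclic sum and `χ_G` is half the Cartan form, hence the factor
`¼`. -/
theorem schouten_iff (f g h : SmoothMap E M ℝ) :
    (∀ x, P.schoutenSquare f g h x =
      B.trivector (ρ.dualMap x (diff f x)) (ρ.dualMap x (diff g x)) (ρ.dualMap x (diff h x))) ↔
    P.poisson f (P.poisson g h) + P.poisson g (P.poisson h f) + P.poisson h (P.poisson f g) =
      (1 / 4 : ℝ) • B.pairing (moment ρ B (diff f))
          (pointwiseLie (moment ρ B (diff g)) (moment ρ B (diff h))) := by
  rw [ContMDiffMap.ext_iff]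
  refine forall_congr' fun x ↦ ?_
  rw [trivector_dualMap ρ B]
  change 2 * (P.poisson f (P.poisson g h) + P.poisson g (P.poisson h f)
    + P.poisson h (P.poisson f g)) x = _ ↔ _ = (1 / 4 : ℝ) * B.form (moment ρ B (diff f) x)
      ⁅moment ρ B (diff g) x, moment ρ B (diff h) x⁆
  constructor <;> intro h <;> linarith

theorem IsQuasiPoisson.anchorDefect_eq_zero (H : IsQuasiPoisson ρ B P)
    (ξ η : OneForm E M × SmoothMap E M 𝔤) (h : SmoothMap E M ℝ) :
    anchorDefect ρ B P ξ η h = 0 := by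
  have h1 (f g : SmoothMap E M ℝ) : anchorDefect ρ B P (diff f, 0) (diff g, 0) h = 0 := by
    rw [anchorDefect_diff_diff, (schouten_iff ρ B P f g h).1 (H.schouten f g h), sub_self]
  have h2 (v : 𝔤) (f : SmoothMap E M ℝ) :
      anchorDefect ρ B P (0, ContMDiffMap.const v) (diff f, 0) h = 0 := by
    rw [anchorDefect_const_diff, ← lieDeriv_diff_diff, H.invariant]
  -- Tensoriality in the second slot, then, after a swap, in the first, leaves four pairs of
  -- generators.
  refine anchorDefect_eq_zero_right ρ B P (fun f ↦ ?_) (fun v ↦ ?_) η <;>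
    rw [anchorDefect_swap, neg_eq_zero] <;>
    refine anchorDefect_eq_zero_right ρ B P (fun g ↦ ?_) (fun w ↦ ?_) ξ
  · exact h1 f g
  · rw [anchorDefect_swap, h2, neg_zero]
  · exact h2 v g
  · exact anchorDefect_const_const ρ B P v w h

theorem isQuasiPoisson_of_anchorSection_bracket
    (H : ∀ ξ η, anchorSection ρ P (bracket ρ B P ξ η) =
      vfBracket (anchorSection ρ P ξ) (anchorSection ρ P η)) : IsQuasiPoisson ρ B P where
  invariant v α β := by
    -- On `(v, α)`, anchor preservation reads `π♯(L_v α) = [ρ_M(v), π♯ α]`; paired with `β` this is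
    -- the invariance of `π`, for arbitrary and not only exact forms.
    have h := H (0, ContMDiffMap.const v) (α, 0)
    rw [bracket_const_form, anchorSection_const, anchorSection_form, anchorSection_form] at h
    rw [BivectorField.lieDeriv, BivectorField.eval, BivectorField.eval, BivectorField.eval,
      pair_lieDerivative, h]
    abel
  schouten f g h := by
    refine (schouten_iff ρ B P f g h).2 (sub_eq_zero.1 ?_)
    rw [← anchorDefect_diff_diff]
    exact (anchorSection_bracket_iff ρ B P _ _).1 (H _ _) h

end AnchorCalculus

/-! ### The Jacobiator: its failure of tensoriality and its values on generators. -/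

section Jacobi

variable {E : Type*} [NormedAddCommGroup E] [NormedSpace ℝ E] [FiniteDimensional ℝ E]
  {M : Type*} [TopologicalSpace M] [T2Space M] [ChartedSpace E M] [IsManifold 𝓘(ℝ, E) ∞ M]
  {𝔤 : Type*} [NormedLieAlgebra 𝔤] [FiniteDimensional ℝ 𝔤]
  (ρ : InfinitesimalAction 𝔤 E M) (B : InvariantForm 𝔤) (P : BivectorField E M)

/-- The Jacobiator of the bracket on `Ω¹(M) ⊕ C^∞(M, 𝔤)`. -/
noncomputable def jacobiator (ξ η ζ : OneForm E M × SmoothMap E M 𝔤) :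
    OneForm E M × SmoothMap E M 𝔤 :=
  bracket ρ B P ξ (bracket ρ B P η ζ) + bracket ρ B P η (bracket ρ B P ζ ξ)
    + bracket ρ B P ζ (bracket ρ B P ξ η)

theorem jacobiator_rotate (ξ η ζ : OneForm E M × SmoothMap E M 𝔤) :
    jacobiator ρ B P ξ η ζ = jacobiator ρ B P η ζ ξ := by
  rw [jacobiator, jacobiator]
  abel

theorem bracket_neg_right (ξ η : OneForm E M × SmoothMap E M 𝔤) :
    bracket ρ B P ξ (-η) = -bracket ρ B P ξ η :=
  map_neg (AddMonoidHom.mk' (bracket ρ B P ξ) (bracket_add_right ρ B P ξ)) η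

theorem bracket_add_left (ξ η ζ : OneForm E M × SmoothMap E M 𝔤) :
    bracket ρ B P (ξ + η) ζ = bracket ρ B P ξ ζ + bracket ρ B P η ζ := by
  rw [bracket_swap, bracket_add_right, neg_add, ← bracket_swap, ← bracket_swap]

theorem jacobiator_add (ξ η ζ ζ' : OneForm E M × SmoothMap E M 𝔤) :
    jacobiator ρ B P ξ η (ζ + ζ') = jacobiator ρ B P ξ η ζ + jacobiator ρ B P ξ η ζ' := by
  simp only [jacobiator, bracket_add_right, bracket_add_left]
  abel

/-- The link between Jacobi and the anchor: the terms with one derivative of `f` cancel, and the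
second-order terms are exactly the anchor defect applied to `f`. -/
theorem jacobiator_sumSMul (ξ η ζ : OneForm E M × SmoothMap E M 𝔤) (f : SmoothMap E M ℝ) :
    jacobiator ρ B P ξ η (sumSMul f ζ) =
      sumSMul f (jacobiator ρ B P ξ η ζ) + sumSMul (anchorDefect ρ B P ξ η f) ζ := by
  -- In this form `ζ` is always the rightmost entry, so the Leibniz identity in the second argument
  -- suffices.
  have e1 (ξ η ζ : OneForm E M × SmoothMap E M 𝔤) : jacobiator ρ B P ξ η ζ =
      bracket ρ B P ξ (bracket ρ B P η ζ) - bracket ρ B P η (bracket ρ B P ξ ζ)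
        - bracket ρ B P (bracket ρ B P ξ η) ζ := by
    rw [jacobiator, bracket_swap ρ B P ζ ξ, bracket_neg_right,
      bracket_swap ρ B P ζ (bracket ρ B P ξ η)]
    abel
  have a1 (f g : SmoothMap E M ℝ) (ξ : OneForm E M × SmoothMap E M 𝔤) :
      sumSMul (f - g) ξ = sumSMul f ξ - sumSMul g ξ :=
    Prod.ext (by ext x; exact congrFun (congrArg DFunLike.coe (sub_smul (f x) (g x) (ξ.1 x))) _)
      (by ext x; exact sub_smul (f x) (g x) (ξ.2 x))
  have a2 (f : SmoothMap E M ℝ) (ξ η : OneForm E M × SmoothMap E M 𝔤) :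
      sumSMul f (ξ - η) = sumSMul f ξ - sumSMul f η :=
    Prod.ext (by ext x; exact congrFun (congrArg DFunLike.coe (smul_sub (f x) (ξ.1 x) (η.1 x))) _)
      (by ext x; exact smul_sub (f x) (ξ.2 x) (η.2 x))
  rw [e1, e1, anchorDefect]
  simp only [bracket_sumSMul, bracket_add_right, a1, a2]
  abel

theorem anchorSection_bracket_of_jacobiator (H : ∀ ξ η ζ, jacobiator ρ B P ξ η ζ = 0)
    (ξ η : OneForm E M × SmoothMap E M 𝔤) : anchorSection ρ P (bracket ρ B P ξ η) =
      vfBracket (anchorSection ρ P ξ) (anchorSection ρ P η) := by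
  refine (anchorSection_bracket_iff ρ B P ξ η).2 fun f ↦ ?_
  -- The same `f` serves as coefficient and as potential, so that what remains is `(Z f) df = 0`
  -- with `Z` the defect field.
  have h := jacobiator_sumSMul ρ B P ξ η (diff f, 0) f
  have hz : sumSMul f (0 : OneForm E M × SmoothMap E M 𝔤) = 0 :=
    Prod.ext (by ext x; exact congrFun (congrArg DFunLike.coe (smul_zero (f x))) _)
      (by ext x; exact smul_zero (f x))
  rw [H, H, hz, zero_add] at h
  let Z : SmoothVectorField E M := vfBracket (anchorSection ρ P ξ) (anchorSection ρ P η)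
    - anchorSection ρ P (bracket ρ B P ξ η)
  have hZ : anchorDefect ρ B P ξ η f = dirDeriv Z f := by
    rw [anchorDefect, ← dirDeriv_vfBracket]
    ext x
    exact (map_sub (mvfderiv 𝓘(ℝ, E) f x) (vfBracket (anchorSection ρ P ξ) (anchorSection ρ P η) x)
      (anchorSection ρ P (bracket ρ B P ξ η) x)).symm
  rw [hZ] at h ⊢
  ext x
  -- Evaluating `(Z f) df` on `Z` gives the square of `Z f`.
  have := congrArg (fun ζ : OneForm E M × SmoothMap E M 𝔤 ↦ ζ.1 x (Z x)) h
  exact mul_self_eq_zero.1 this.symm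

theorem jacobiator_eq_zero_right
    (H : ∀ ξ η h, anchorDefect ρ B P ξ η h = 0) {ξ η : OneForm E M × SmoothMap E M 𝔤}
    (hd : ∀ f, jacobiator ρ B P ξ η (diff f, 0) = 0)
    (hc : ∀ v, jacobiator ρ B P ξ η (0, ContMDiffMap.const v) = 0)
    (ζ : OneForm E M × SmoothMap E M 𝔤) : jacobiator ρ B P ξ η ζ = 0 := by
  have key (x : M) : ((jacobiator ρ B P ξ η ζ).1 x, (jacobiator ρ B P ξ η ζ).2 x) = 0 := by
    let T : OneForm E M × SmoothMap E M 𝔤 →+ (TangentSpace 𝓘(ℝ, E) x →L[ℝ] ℝ) × 𝔤 :=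
      AddMonoidHom.mk'
        (fun ζ ↦ ((jacobiator ρ B P ξ η ζ).1 x, (jacobiator ρ B P ξ η ζ).2 x)) fun η ζ ↦ by
          rw [jacobiator_add]
          rfl
    refine eq_zero_of_tensorial T (x := x) (fun f η ↦ ?_) (fun f ↦ ?_) (fun v ↦ ?_) ζ
    · change ((jacobiator ρ B P ξ _ (sumSMul f η)).1 x, (jacobiator ρ B P ξ _ (sumSMul f η)).2 x) = _
      rw [jacobiator_sumSMul, H]
      refine Prod.ext ?_ ?_
      · change f x • _ + (0 : ℝ) • η.1 x = _
        rw [zero_smul, add_zero]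
        rfl
      · change f x • _ + (0 : ℝ) • η.2 x = _
        rw [zero_smul, add_zero]
        rfl
    · exact congrArg (fun ζ : OneForm E M × SmoothMap E M 𝔤 ↦ (ζ.1 x, ζ.2 x)) (hd f)
    · exact congrArg (fun ζ : OneForm E M × SmoothMap E M 𝔤 ↦ (ζ.1 x, ζ.2 x)) (hc v)
  refine Prod.ext ?_ ?_
  · ext x w
    exact congrArg (fun p : (TangentSpace 𝓘(ℝ, E) x →L[ℝ] ℝ) × 𝔤 ↦ p.1 w) (key x)
  · ext x
    exact congrArg (fun p : (TangentSpace 𝓘(ℝ, E) x →L[ℝ] ℝ) × 𝔤 ↦ p.2) (key x)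

/-- With `u` frozen at its value at `x`, `L_v df = d(v f) = d⟨μ_f, v⟩`; hence only `μ_f` is
differentiated, never `u`. -/
theorem actionLie_diff_apply (u : SmoothMap E M 𝔤) (f : SmoothMap E M ℝ) (x : M)
    (w : TangentSpace 𝓘(ℝ, E) x) : actionLie ρ u (diff f) x w =
      B.form (mvfderiv 𝓘(ℝ, E) (moment ρ B (diff f)) x w) (u x) := by
  change lieDerivative (ρ.toFun (u x)) (diff f) x w = _
  rw [lieDerivative_diff, ← pairing_moment_diff_const ρ B]
  change mvfderiv 𝓘(ℝ, E) (B.pairing (moment ρ B (diff f)) (ContMDiffMap.const (u x))) x w = _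
  have h : mvfderiv 𝓘(ℝ, E) (ContMDiffMap.const (u x) : SmoothMap E M 𝔤) x w = 0 := by
    change mvfderiv 𝓘(ℝ, E) (fun _ ↦ u x) x w = 0
    rw [mvfderiv_const]
    rfl
  rw [mvfderiv_pairing, h, map_zero, add_zero]
  rfl

theorem bracket_form_map (α : OneForm E M) (u : SmoothMap E M 𝔤) :
    bracket ρ B P (α, 0) (0, u) = (-actionLie ρ u α, dirDeriv (P.sharpForm α) u) := by
  have h1 : P.formBracket α 0 = 0 := by
    have := congrArg Prod.fst (bracket_swap ρ B P (α, 0) (0, 0))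
    rw [bracket_forms, bracket_forms, formBracket_zero_left] at this
    simpa using this
  have h2 : contractForms ρ B α 0 = 0 := by
    have := congrArg Prod.snd (bracket_swap ρ B P (α, 0) (0, 0))
    rw [bracket_forms, bracket_forms, contractForms_zero_left] at this
    simpa using this
  have h3 : pointwiseLie (0 : SmoothMap E M 𝔤) u = 0 := by
    ext x
    exact zero_lie (u x)
  simp [bracket, h1, h2, h3, actionLie_zero, anchorSection_form, dirDeriv_zero]

theorem bracket_const_map (v : 𝔤) (u : SmoothMap E M 𝔤) :
    bracket ρ B P (0, ContMDiffMap.const v) (0, u) =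
      (0, pointwiseLie (ContMDiffMap.const v) u + dirDeriv (ρ.toFun v) u) := by
  simp [bracket, actionLie_zero, dirDeriv_const, formBracket_zero_left,
    contractForms_zero_left, anchorSection_const]

theorem jacobiator_const_const_const (u v w : 𝔤) :
    jacobiator ρ B P (0, ContMDiffMap.const u) (0, ContMDiffMap.const v)
      (0, ContMDiffMap.const w) = 0 := by
  simp only [jacobiator, bracket_const]
  refine Prod.ext (by simp) ?_
  ext x
  exact lie_jacobi u v w

theorem jacobiator_const_const_diff (v w : 𝔤) (f : SmoothMap E M ℝ) :
    jacobiator ρ B P (0, ContMDiffMap.const v) (0, ContMDiffMap.const w) (diff f, 0) = 0 := by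
  rw [jacobiator, bracket_swap ρ B P (diff f, 0) (0, ContMDiffMap.const v), bracket_neg_right,
    bracket_swap ρ B P (diff f, 0) (bracket ρ B P _ _)]
  simp only [bracket_const, bracket_const_diff, dirDeriv_action_lie]
  refine Prod.ext ?_ (by simp)
  simp only [sub_eq_add_neg, diff_add, diff_neg, Prod.fst_add, Prod.fst_neg, Prod.fst_zero]
  abel

variable {ρ B P}

/-- Here `hP` is the invariance of `π` on exact forms; it disposes of the 1-form component. -/
theorem jacobiator_const_diff_diff
    (hP : ∀ (v : 𝔤) (f h : SmoothMap E M ℝ), dirDeriv (ρ.toFun v) (P.poisson f h) =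
      P.poisson (dirDeriv (ρ.toFun v) f) h + P.poisson f (dirDeriv (ρ.toFun v) h))
    (v : 𝔤) (f g : SmoothMap E M ℝ) :
    jacobiator ρ B P (0, ContMDiffMap.const v) (diff f, 0) (diff g, 0) = 0 := by
  have e (u : SmoothMap E M 𝔤) (h : SmoothMap E M ℝ) :
      ((diff h, u) : OneForm E M × SmoothMap E M 𝔤) = (diff h, 0) + (0, u) := by simp
  rw [jacobiator, bracket_swap ρ B P (diff g, 0) (0, ContMDiffMap.const v), bracket_neg_right,
    bracket_const_diff, bracket_const_diff, bracket_diff_diff, bracket_diff_diff,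
    bracket_diff_diff, e, bracket_add_right, bracket_const_diff, bracket_const_map]
  refine Prod.ext ?_ ?_
  · have h := hP v f g
    rw [P.poisson_swap (dirDeriv (ρ.toFun v) f) g] at h
    simp only [h, diff_add, diff_neg, Prod.fst_add, Prod.fst_neg, Prod.fst_zero]
    abel
  -- By equivariance of the moments the derivative terms cancel, leaving the Jacobi identity in `𝔤`
  -- for `v, μ_f, μ_g`.
  · rw [moment_diff_dirDeriv, moment_diff_dirDeriv, dirDeriv_const_smul, dirDeriv_pointwiseLie]
    ext x
    simp only [Prod.snd_add, Prod.snd_neg, Prod.snd_zero, zero_add]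
    set a := moment ρ B (diff f)
    set b := moment ρ B (diff g)
    change ⁅v, (1 / 4 : ℝ) • ⁅a x, b x⁆⁆ + (1 / 4 : ℝ) •
        (⁅dirDeriv (ρ.toFun v) a x, b x⁆ + ⁅a x, dirDeriv (ρ.toFun v) b x⁆)
      + -((1 / 4 : ℝ) • ⁅a x, dirDeriv (ρ.toFun v) b x - ⁅b x, v⁆⁆)
      + (1 / 4 : ℝ) • ⁅b x, dirDeriv (ρ.toFun v) a x - ⁅a x, v⁆⁆ = 0
    have h1 : ⁅dirDeriv (ρ.toFun v) a x, b x⁆ = -⁅b x, dirDeriv (ρ.toFun v) a x⁆ :=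
      (lie_skew _ _).symm
    have h2 := lie_jacobi v (a x) (b x)
    have h3 : ⁅b x, ⁅a x, v⁆⁆ = -⁅b x, ⁅v, a x⁆⁆ := by rw [← lie_skew (a x) v, lie_neg]
    have h4 : ⁅v, ⁅a x, b x⁆⁆ = -⁅a x, ⁅b x, v⁆⁆ - ⁅b x, ⁅v, a x⁆⁆ := by
      rw [sub_eq_add_neg, ← sub_eq_zero]
      rw [← h2]
      abel
    rw [lie_smul, lie_sub, lie_sub, h1, h3, h4]
    module

/-- Paired with a constant `v`, this is the derivation property `v{f,g} = {v f, g} + {f, v g}`. -/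
theorem moment_diff_poisson
    (hP : ∀ (v : 𝔤) (f h : SmoothMap E M ℝ), dirDeriv (ρ.toFun v) (P.poisson f h) =
      P.poisson (dirDeriv (ρ.toFun v) f) h + P.poisson f (dirDeriv (ρ.toFun v) h))
    (f g : SmoothMap E M ℝ) : moment ρ B (diff (P.poisson f g)) =
    dirDeriv (P.sharpForm (diff f)) (moment ρ B (diff g))
      - dirDeriv (P.sharpForm (diff g)) (moment ρ B (diff f)) := by
  refine SmoothMap.eq_of_pairing_eq B fun v ↦ ?_
  have h : B.pairing (dirDeriv (P.sharpForm (diff f)) (moment ρ B (diff g))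
      - dirDeriv (P.sharpForm (diff g)) (moment ρ B (diff f))) (ContMDiffMap.const v) =
      B.pairing (dirDeriv (P.sharpForm (diff f)) (moment ρ B (diff g))) (ContMDiffMap.const v)
      - B.pairing (dirDeriv (P.sharpForm (diff g)) (moment ρ B (diff f)))
        (ContMDiffMap.const v) := by
    ext x
    change B.form (_ - _) v = _
    rw [map_sub]
    rfl
  rw [h, ← dirDeriv_pairing_const, ← dirDeriv_pairing_const, pairing_moment_diff_const,
    pairing_moment_diff_const, pairing_moment_diff_const, hP, dirDeriv_sharpForm_diff,
    dirDeriv_sharpForm_diff, P.poisson_swap g]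
  abel

theorem jacobiator_diff_diff_diff
    (hP : ∀ (v : 𝔤) (f h : SmoothMap E M ℝ), dirDeriv (ρ.toFun v) (P.poisson f h) =
      P.poisson (dirDeriv (ρ.toFun v) f) h + P.poisson f (dirDeriv (ρ.toFun v) h))
    (f g h : SmoothMap E M ℝ)
    (hS : P.poisson f (P.poisson g h) + P.poisson g (P.poisson h f) + P.poisson h (P.poisson f g) =
      (1 / 4 : ℝ) • B.pairing (moment ρ B (diff f))
          (pointwiseLie (moment ρ B (diff g)) (moment ρ B (diff h)))) :
    jacobiator ρ B P (diff f, 0) (diff g, 0) (diff h, 0) = 0 := by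
  have e (u : SmoothMap E M 𝔤) (h : SmoothMap E M ℝ) :
      ((diff h, u) : OneForm E M × SmoothMap E M 𝔤) = (diff h, 0) + (0, u) := by simp
  rw [jacobiator, bracket_diff_diff, bracket_diff_diff, bracket_diff_diff, e _ (P.poisson g h),
    e _ (P.poisson h f),
    e _ (P.poisson f g), bracket_add_right, bracket_add_right, bracket_add_right,
    bracket_diff_diff, bracket_diff_diff, bracket_diff_diff, bracket_form_map, bracket_form_map,
    bracket_form_map]
  refine Prod.ext ?_ ?_
  -- The 1-form component is the differential of `hS`: the three terms of `d⟨μ_f, [μ_g, μ_h]⟩` match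
  -- the three action terms.
  · have hd := congrArg diff hS
    rw [diff_add, diff_add, diff_const_smul] at hd
    ext x w
    have hd' := congrArg (fun α : OneForm E M ↦ α x w) hd
    change diff (P.poisson f (P.poisson g h)) x w + diff (P.poisson g (P.poisson h f)) x w
      + diff (P.poisson h (P.poisson f g)) x w = (1 / 4 : ℝ) * mvfderiv 𝓘(ℝ, E)
        (B.pairing (moment ρ B (diff f))
          (pointwiseLie (moment ρ B (diff g)) (moment ρ B (diff h)))) x w at hd'
    rw [mvfderiv_pairing, mvfderiv_pointwiseLie] at hd'
    change (diff (P.poisson f (P.poisson g h)) x w + -actionLie ρ _ (diff f) x w)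
      + (diff (P.poisson g (P.poisson h f)) x w + -actionLie ρ _ (diff g) x w)
      + (diff (P.poisson h (P.poisson f g)) x w + -actionLie ρ _ (diff h) x w) = 0
    rw [actionLie_diff_apply ρ B, actionLie_diff_apply ρ B, actionLie_diff_apply ρ B]
    set a := moment ρ B (diff f)
    set b := moment ρ B (diff g)
    set c := moment ρ B (diff h)
    set a' := mvfderiv 𝓘(ℝ, E) a x w
    set b' := mvfderiv 𝓘(ℝ, E) b x w
    set c' := mvfderiv 𝓘(ℝ, E) c x w
    change _ = 1 / 4 * (B.form a' ⁅b x, c x⁆ + _) at hd'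
    change _ + -B.form a' ((1 / 4 : ℝ) • ⁅b x, c x⁆) + (_ + -B.form b' ((1 / 4 : ℝ) • ⁅c x, a x⁆))
      + (_ + -B.form c' ((1 / 4 : ℝ) • ⁅a x, b x⁆)) = 0
    -- Invariance of the form rotates the differentiated factor into the first slot, where the
    -- action terms have it.
    have h2 : B.form (a x) ⁅b', c x⁆ = B.form b' ⁅c x, a x⁆ := by
      rw [B.form_lie b', B.form_comm]
    have h3 : B.form (a x) ⁅b x, c'⁆ = B.form c' ⁅a x, b x⁆ := by
      rw [B.form_lie (a x), B.form_comm]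
    rw [map_add, h2, h3] at hd'
    rw [map_smul, map_smul, map_smul, smul_eq_mul, smul_eq_mul, smul_eq_mul]
    linarith
  -- In the `𝔤` component each derivative of a moment occurs twice; the pairs cancel by
  -- skew-symmetry alone, without the Jacobi identity.
  · rw [moment_diff_poisson hP, moment_diff_poisson hP, moment_diff_poisson hP,
      dirDeriv_const_smul, dirDeriv_const_smul, dirDeriv_const_smul, dirDeriv_pointwiseLie,
      dirDeriv_pointwiseLie, dirDeriv_pointwiseLie]
    ext x
    set a := moment ρ B (diff f)
    set b := moment ρ B (diff g)
    set c := moment ρ B (diff h)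
    set X := P.sharpForm (diff f)
    set Y := P.sharpForm (diff g)
    set Z := P.sharpForm (diff h)
    change ((1 / 4 : ℝ) • ⁅a x, dirDeriv Y c x - dirDeriv Z b x⁆
        + (1 / 4 : ℝ) • (⁅dirDeriv X b x, c x⁆ + ⁅b x, dirDeriv X c x⁆))
      + ((1 / 4 : ℝ) • ⁅b x, dirDeriv Z a x - dirDeriv X c x⁆
        + (1 / 4 : ℝ) • (⁅dirDeriv Y c x, a x⁆ + ⁅c x, dirDeriv Y a x⁆))
      + ((1 / 4 : ℝ) • ⁅c x, dirDeriv X b x - dirDeriv Y a x⁆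
        + (1 / 4 : ℝ) • (⁅dirDeriv Z a x, b x⁆ + ⁅a x, dirDeriv Z b x⁆)) = 0
    rw [← lie_skew (dirDeriv X b x) (c x), ← lie_skew (dirDeriv Y c x) (a x),
      ← lie_skew (dirDeriv Z a x) (b x)]
    simp only [lie_sub]
    module

theorem IsQuasiPoisson.jacobiator_eq_zero (H : IsQuasiPoisson ρ B P)
    (ξ η ζ : OneForm E M × SmoothMap E M 𝔤) : jacobiator ρ B P ξ η ζ = 0 := by
  have hP (v : 𝔤) (f h : SmoothMap E M ℝ) : dirDeriv (ρ.toFun v) (P.poisson f h) =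
      P.poisson (dirDeriv (ρ.toFun v) f) h + P.poisson f (dirDeriv (ρ.toFun v) h) := by
    have := H.invariant v (diff f) (diff h)
    rwa [lieDeriv_diff_diff, sub_sub, sub_eq_zero] at this
  have R {ξ η : OneForm E M × SmoothMap E M 𝔤} :=
    jacobiator_eq_zero_right (ξ := ξ) (η := η) ρ B P (H.anchorDefect_eq_zero ρ B P)
  have ddd (f g h : SmoothMap E M ℝ) :=
    jacobiator_diff_diff_diff hP f g h ((schouten_iff ρ B P f g h).1 (H.schouten f g h))
  have cdd (v : 𝔤) (f g : SmoothMap E M ℝ) := jacobiator_const_diff_diff (B := B) hP v f g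
  have ccd := jacobiator_const_const_diff ρ B P
  have ccc := jacobiator_const_const_const ρ B P
  -- Rotation brings each slot in turn to the last place, where tensoriality applies; the eight
  -- resulting cases are four up to rotation.
  refine R (fun f ↦ ?_) (fun u ↦ ?_) ζ <;> rw [← jacobiator_rotate] <;>
    refine R (fun g ↦ ?_) (fun v ↦ ?_) η <;> rw [← jacobiator_rotate] <;>
    refine R (fun h ↦ ?_) (fun w ↦ ?_) ξ
  · exact ddd g f h
  · rw [← jacobiator_rotate]
    exact cdd w g f
  · exact cdd v f h
  · rw [← jacobiator_rotate]
    exact ccd w v f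
  · rw [jacobiator_rotate]
    exact cdd u h g
  · rw [jacobiator_rotate]
    exact ccd u w g
  · exact ccd v u h
  · exact ccc v u w

end Jacobi

/-! ### The Lie algebroid axioms on sections of `T*M ⊕ 𝔤`. -/

section Algebroid

variable {E : Type*} [NormedAddCommGroup E] [NormedSpace ℝ E] [FiniteDimensional ℝ E]
  {M : Type*} [TopologicalSpace M] [T2Space M] [ChartedSpace E M] [IsManifold 𝓘(ℝ, E) ∞ M]
  {𝔤 : Type*} [NormedLieAlgebra 𝔤] [FiniteDimensional ℝ 𝔤]
  (ρ : InfinitesimalAction 𝔤 E M) (B : InvariantForm 𝔤) (P : BivectorField E M)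

/-- Smoothness of a vector field along a map is read in one fixed trivialization, where the fibre
coordinate is linear and takes values in `E`, so that sums and multiples can be handled. -/
theorem contMDiffAt_vectorField_along_iff {E' H N : Type*} [NormedAddCommGroup E']
    [NormedSpace ℝ E'] [TopologicalSpace H] {I : ModelWithCorners ℝ E' H} [TopologicalSpace N]
    [ChartedSpace H N] {b : N → M} {q : N} (hb : ContMDiffAt I 𝓘(ℝ, E) ∞ b q)
    (s : ∀ n, TangentSpace 𝓘(ℝ, E) (b n)) :
    ContMDiffAt I (𝓘(ℝ, E).prod 𝓘(ℝ, E)) ∞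
      (fun n ↦ (⟨b n, s n⟩ : TotalSpace E (TangentSpace 𝓘(ℝ, E) : M → Type _))) q ↔
    ContMDiffAt I 𝓘(ℝ, E) ∞ (fun n ↦ (trivializationAt E (TangentSpace 𝓘(ℝ, E) : M → Type _)
      (b q)).continuousLinearMapAt ℝ (b n) (s n)) q := by
  rw [contMDiffAt_totalSpace]
  refine (and_iff_right hb).trans (Filter.EventuallyEq.contMDiffAt_iff ?_)
  filter_upwards [hb.continuousAt.preimage_mem_nhds
    ((trivializationAt E (TangentSpace 𝓘(ℝ, E) : M → Type _) (b q)).open_baseSet.mem_nhds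
      (FiberBundle.mem_baseSet_trivializationAt' (F := E) (b q)))] with n hn
  exact (congrFun (Trivialization.coe_linearMapAt_of_mem _ hn) (s n)).symm

/-- Along the bundle projection the anchor is `π♯` of the tautological covector plus `∑ uⁱ ρ_M(eᵢ)`,
with `uⁱ` the linear coordinates of the `𝔤` component. -/
theorem contMDiff_anchor : ContMDiff (𝓘(ℝ, E).prod 𝓘(ℝ, (E →L[ℝ] ℝ) × 𝔤))
    (𝓘(ℝ, E).prod 𝓘(ℝ, E)) ∞
    (fun p : TotalSpace ((E →L[ℝ] ℝ) × 𝔤)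
      ((fun x : M ↦ TangentSpace 𝓘(ℝ, E) x →L[ℝ] ℝ) ×ᵇ Bundle.Trivial M 𝔤) ↦
      (⟨p.1, anchor ρ P p.1 p.2⟩ : TotalSpace E (TangentSpace 𝓘(ℝ, E) : M → Type _))) := by
  intro q
  have hid := (contMDiffAt_totalSpace (IB := 𝓘(ℝ, E)) (n := ∞)
    (IM := 𝓘(ℝ, E).prod 𝓘(ℝ, (E →L[ℝ] ℝ) × 𝔤)) (x₀ := q) (f := id)).1 contMDiffAt_id
  obtain ⟨hproj, hcoord⟩ := hid
  obtain ⟨h1, h2⟩ := (contMDiffAt_prod_module_iff _).1 hcoord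
  have hα : ContMDiffAt (𝓘(ℝ, E).prod 𝓘(ℝ, (E →L[ℝ] ℝ) × 𝔤)) (𝓘(ℝ, E).prod 𝓘(ℝ, E →L[ℝ] ℝ)) ∞
      (fun p : TotalSpace ((E →L[ℝ] ℝ) × 𝔤)
        ((fun x : M ↦ TangentSpace 𝓘(ℝ, E) x →L[ℝ] ℝ) ×ᵇ Bundle.Trivial M 𝔤) ↦
        TotalSpace.mk' (E →L[ℝ] ℝ) (E := fun x : M ↦ TangentSpace 𝓘(ℝ, E) x →L[ℝ] ℝ)
          p.1 p.2.1) q := contMDiffAt_totalSpace.2 ⟨hproj, h1⟩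
  have hs := ContMDiffAt.clm_bundle_apply ((P.sharp.contMDiff _).comp q hproj) hα
  have hv (i) := (ρ.toFun (Module.finBasis ℝ 𝔤 i)).contMDiff.contMDiffAt.comp q hproj
  have hs' := (contMDiffAt_vectorField_along_iff hproj _).1 hs
  have hv' (i) := (contMDiffAt_vectorField_along_iff hproj _).1 (hv i)
  have hu : ContMDiffAt (𝓘(ℝ, E).prod 𝓘(ℝ, (E →L[ℝ] ℝ) × 𝔤)) 𝓘(ℝ, 𝔤) ∞
      (fun p : TotalSpace ((E →L[ℝ] ℝ) × 𝔤)
        ((fun x : M ↦ TangentSpace 𝓘(ℝ, E) x →L[ℝ] ℝ) ×ᵇ Bundle.Trivial M 𝔤) ↦ (p.2.2 : 𝔤)) q := h2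
  have hc (i) := (LinearMap.toContinuousLinearMap
    ((Module.finBasis ℝ 𝔤).coord i)).contMDiff.contMDiffAt.comp q hu
  refine (contMDiffAt_vectorField_along_iff hproj _).2 ?_
  refine (hs'.add (contMDiffAt_finsetSum (t := Finset.univ)
    fun i _ ↦ (hc i).smul (hv' i))).congr_of_eventuallyEq (.of_forall fun p ↦ ?_)
  have h : anchor ρ P p.1 p.2 = P.sharp p.1 p.2.1 + ∑ i,
      (Module.finBasis ℝ 𝔤).coord i p.2.2 • ρ.toFun (Module.finBasis ℝ 𝔤 i) p.1 := by
    change _ + ρ.toFun p.2.2 p.1 = _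
    rw [ρ.apply_eq_sum, section_sum_apply]
    rfl
  simp only [h, map_add, map_sum, map_smul]
  rfl

theorem bracket_smul_right (c : ℝ) (ξ η : OneForm E M × SmoothMap E M 𝔤) :
    bracket ρ B P ξ (c • η) = c • bracket ρ B P ξ η := by
  -- A real scalar is a constant function, so the derivative term in the Leibniz identity vanishes.
  have h (ζ : OneForm E M × SmoothMap E M 𝔤) : c • ζ = sumSMul (ContMDiffMap.const c) ζ := rfl
  have h0 : sumSMul (0 : SmoothMap E M ℝ) η = 0 :=
    Prod.ext (by ext x; exact congrFun (congrArg DFunLike.coe (zero_smul ℝ (η.1 x))) _)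
      (by ext x; exact zero_smul ℝ (η.2 x))
  rw [h, h, bracket_sumSMul, dirDeriv_const, h0, add_zero]

theorem bracket_smul_left (c : ℝ) (ξ η : OneForm E M × SmoothMap E M 𝔤) :
    bracket ρ B P (c • ξ) η = c • bracket ρ B P ξ η := by
  rw [bracket_swap, bracket_smul_right, bracket_swap ρ B P ξ η]
  exact Prod.ext (smul_neg c (bracket ρ B P η ξ).1).symm
    (by ext x; exact (smul_neg c ((bracket ρ B P η ξ).2 x)).symm)

theorem bracket_self (ξ : OneForm E M × SmoothMap E M 𝔤) : bracket ρ B P ξ ξ = 0 := by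
  have h := bracket_swap ρ B P ξ ξ
  refine Prod.ext ?_ ?_
  · ext x w
    exact self_eq_neg.1 (congrArg (fun ζ : OneForm E M × SmoothMap E M 𝔤 ↦ ζ.1 x w) h)
  · ext x
    have hx : (bracket ρ B P ξ ξ).2 x = -(bracket ρ B P ξ ξ).2 x :=
      congrArg (fun ζ : OneForm E M × SmoothMap E M 𝔤 ↦ ζ.2 x) h
    refine (smul_eq_zero.1 (?_ : (2 : ℝ) • (bracket ρ B P ξ ξ).2 x = 0)).resolve_left two_ne_zero
    rw [two_smul]
    exact eq_neg_iff_add_eq_zero.1 hx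

theorem isLieAlgebroid_of_jacobiator (H : ∀ ξ η ζ, jacobiator ρ B P ξ η ζ = 0) :
    IsLieAlgebroid (anchor ρ P) (sumBracket ρ B P) where
  contMDiff_anchor := contMDiff_anchor ρ P
  add_left ξ η ζ := congrArg (sectionEquiv 𝔤).symm
    (bracket_add_left ρ B P (sectionEquiv 𝔤 ξ) (sectionEquiv 𝔤 η) (sectionEquiv 𝔤 ζ))
  add_right ξ η ζ := congrArg (sectionEquiv 𝔤).symm
    (bracket_add_right ρ B P (sectionEquiv 𝔤 ξ) (sectionEquiv 𝔤 η) (sectionEquiv 𝔤 ζ))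
  smul_left c ξ η := congrArg (sectionEquiv 𝔤).symm
    (bracket_smul_left ρ B P c (sectionEquiv 𝔤 ξ) (sectionEquiv 𝔤 η))
  smul_right c ξ η := congrArg (sectionEquiv 𝔤).symm
    (bracket_smul_right ρ B P c (sectionEquiv 𝔤 ξ) (sectionEquiv 𝔤 η))
  self ξ := congrArg (sectionEquiv 𝔤).symm (bracket_self ρ B P (sectionEquiv 𝔤 ξ))
  jacobi ξ η ζ := congrArg (sectionEquiv 𝔤).symm
    (H (sectionEquiv 𝔤 ξ) (sectionEquiv 𝔤 η) (sectionEquiv 𝔤 ζ))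
  leibniz ξ ξ' f x := congrArg (fun s : SumSection E M 𝔤 ↦ s x) (congrArg (sectionEquiv 𝔤).symm
    (bracket_sumSMul ρ B P (sectionEquiv 𝔤 ξ) (sectionEquiv 𝔤 ξ') f))

theorem jacobiator_of_isLieAlgebroid (H : IsLieAlgebroid (anchor ρ P) (sumBracket ρ B P))
    (ξ η ζ : OneForm E M × SmoothMap E M 𝔤) : jacobiator ρ B P ξ η ζ = 0 :=
  congrArg (sectionEquiv 𝔤) (H.jacobi ((sectionEquiv 𝔤).symm ξ) ((sectionEquiv 𝔤).symm η)
    ((sectionEquiv 𝔤).symm ζ))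

end Algebroid

end QPoisson

theorem mainTheorem2
    {E : Type*} [NormedAddCommGroup E] [NormedSpace ℝ E] [FiniteDimensional ℝ E]
    {M : Type*} [TopologicalSpace M] [T2Space M] [SecondCountableTopology M]
    [ChartedSpace E M] [IsManifold 𝓘(ℝ, E) ∞ M]
    {𝔤 : Type*} [NormedLieAlgebra 𝔤] [FiniteDimensional ℝ 𝔤] (B : QPoisson.InvariantForm 𝔤)
    (ρ : QPoisson.InfinitesimalAction 𝔤 E M) (P : QPoisson.BivectorField E M) :
    [ QPoisson.IsQuasiPoisson ρ B P,
      ∀ ξ η : QPoisson.OneForm E M × QPoisson.SmoothMap E M 𝔤,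
        QPoisson.anchorSection ρ P (QPoisson.bracket ρ B P ξ η) =
          QPoisson.vfBracket (QPoisson.anchorSection ρ P ξ) (QPoisson.anchorSection ρ P η),
      ∀ ξ η ζ : QPoisson.OneForm E M × QPoisson.SmoothMap E M 𝔤,
        QPoisson.bracket ρ B P ξ (QPoisson.bracket ρ B P η ζ) + QPoisson.bracket ρ B P η (QPoisson.bracket ρ B P ζ ξ)
          + QPoisson.bracket ρ B P ζ (QPoisson.bracket ρ B P ξ η) = 0,
      QPoisson.IsLieAlgebroid (QPoisson.anchor ρ P) (QPoisson.sumBracket ρ B P) ].TFAE := by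

  tfae_have 1 → 2 := fun H ξ η ↦
    (QPoisson.anchorSection_bracket_iff ρ B P ξ η).2 (H.anchorDefect_eq_zero ρ B P ξ η)
  tfae_have 2 → 1 := QPoisson.isQuasiPoisson_of_anchorSection_bracket ρ B P
  tfae_have 1 → 3 := fun H ↦ H.jacobiator_eq_zero
  tfae_have 3 → 2 := QPoisson.anchorSection_bracket_of_jacobiator ρ B P
  tfae_have 3 → 4 := QPoisson.isLieAlgebroid_of_jacobiator ρ B P
  tfae_have 4 → 3 := QPoisson.jacobiator_of_isLieAlgebroid ρ B P
  tfae_finish
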